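/- Let $\mathcal C$ be a finite set of circles of positive radius in the plane (a system of circles). Its meeting points are the points lying on at least two different circles of $\mathcal C$ (the intersection and touching points), and its arcs are the circular arcs, on circles of $\mathcal C$, that run from one meeting point to the next one. A simple graph $G$ admits a realization as a system of circles if there is such a set $\mathcal C$ for which $V(G)$ is in bijection with the meeting points and $E(G)$ is in bijection with the set of all arcs, so that each edge joins the vertices corresponding to the two ends of its arc. Let $G_{oct}$ be the octahedron graph $K_{2,2,2}$. The gadget with endpoints $v_1,v_2$ has further vertices $w,w_1,w_2$ and edges $(v_i,w)$, $(v_i,w_i)$, $(w_i,w)$ for $i=1,2$, and, for each $i=1,2$, a separate copy of $G_{oct}$ in which one edge is subdivided by a new vertex, which is $w_i$. The graph $G_{oct}^{aug}$ is obtained from $G_{oct}$ by replacing each edge $(u,v)$ by a path $u,z_1,z_2,\dots,z_8,v$ with eight new inner vertices and attaching four copies of the gadget along it, with endpoints $\{z_1,z_6\}$, $\{z_2,z_5\}$, $\{z_3,z_8\}$ and $\{z_4,z_7\}$, respectively. **Theorem.** $G_{oct}^{aug}$ is a connected, 4-regular, planar graph that has a cut vertex (so it is not 2-connected), and it does not admit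 a realization as a system of circles. In particular, there exists a connected 4-regular planar graph that does not admit a realization as a system of circles. -/

import Mathlib

namespace CircleSystem

/-! ### Planar graphs and cut vertices -/

/-- `A` is a simple arc in the plane whose two end points form the unordered pair `ends`. -/
def IsSimpleArc (A : Set ℂ) (ends : Sym2 ℂ) : Prop :=
  ∃ f : unitInterval → ℂ, Continuous f ∧ Function.Injective f ∧
    s(f 0, f 1) = ends ∧ Set.range f = A

/-- `G` is planar: it can be drawn in the plane with distinct points as vertices and simple arcs as
edges, such that an edge contains no vertex other than its two ends and two different edges
meet at most in their common ends. -/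
def IsPlanar {V : Type*} (G : SimpleGraph V) : Prop :=
  ∃ (p : V → ℂ) (arc : Sym2 V → Set ℂ),
    Function.Injective p ∧
    (∀ e ∈ G.edgeSet, IsSimpleArc (arc e) (e.map p)) ∧
    (∀ e ∈ G.edgeSet, ∀ v, p v ∈ arc e → v ∈ e) ∧
    (∀ e ∈ G.edgeSet, ∀ e' ∈ G.edgeSet, e ≠ e' → arc e ∩ arc e' ⊆ p '' {v | v ∈ e ∧ v ∈ e'})

/-- `v` is a cut vertex of the (connected) graph `G`: deleting it disconnects `G`. -/
def IsCutVertex {V : Type*} (G : SimpleGraph V) (v : V) : Prop :=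
  ¬ (G.induce {v}ᶜ).Preconnected

/-! ### Systems of circles -/

/-- A circle in the plane, of positive radius. -/
structure PlaneCircle where
  center : ℂ
  radius : ℝ
  radius_pos : 0 < radius

/-- The points of a circle. -/
def PlaneCircle.points (C : PlaneCircle) : Set ℂ := Metric.sphere C.center C.radius

/-- The intersection and touching points of a set of circles: the points that lie on at least two
different circles. -/
def meetingPoints (S : Finset PlaneCircle) : Set ℂ :=
  {x | ∃ C ∈ S, ∃ D ∈ S, C ≠ D ∧ x ∈ C.points ∧ x ∈ D.points}

/-- `A` is one of the circular arcs into which the meeting points divide the circles of `S`, with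
end points `ends`: it runs on a circle of `S` from one meeting point to the next one. -/
def IsCircularArc (S : Finset PlaneCircle) (A : Set ℂ) (ends : Sym2 ℂ) : Prop :=
  ∃ C ∈ S, ∃ a b : ℝ, a < b ∧ b ≤ a + 2 * Real.pi ∧
    A = circleMap C.center C.radius '' Set.Icc a b ∧
    ends = s(circleMap C.center C.radius a, circleMap C.center C.radius b) ∧
    circleMap C.center C.radius a ∈ meetingPoints S ∧
    circleMap C.center C.radius b ∈ meetingPoints S ∧
    ∀ t ∈ Set.Ioo a b, circleMap C.center C.radius t ∉ meetingPoints S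

/-- `G` admits a realization as a system of circles: for some finite set of circles, the vertices
of `G` are the meeting points of the circles, and the edges of `G` are, one to one, all the
circular arcs between meeting points, each edge joining the ends of its arc. -/
def HasCircleRealization {V : Type*} (G : SimpleGraph V) : Prop :=
  ∃ (S : Finset PlaneCircle) (p : V → ℂ) (arc : Sym2 V → Set ℂ),
    Function.Injective p ∧
    Set.range p = meetingPoints S ∧
    (∀ e ∈ G.edgeSet, IsCircularArc S (arc e) (e.map p)) ∧
    Set.BijOn arc G.edgeSet {A | ∃ ends, IsCircularArc S A ends}

/-! ### The augmented octahedron -/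

/-- The octahedron graph: `i` and `5 - i` are antipodal, all other pairs are adjacent. -/
def octahedron : SimpleGraph (Fin 6) where
  Adj i j := i ≠ j ∧ i.val + j.val ≠ 5
  symm := ⟨fun _ _ h => ⟨h.1.symm, by rw [add_comm]; exact h.2⟩⟩
  loopless := ⟨fun _ h => h.1 rfl⟩

instance : DecidableRel octahedron.Adj := fun i j =>
  inferInstanceAs (Decidable (i ≠ j ∧ i.val + j.val ≠ 5))

/-- The twelve edges of the octahedron, each directed from its smaller to its larger end. -/
abbrev OctEdge : Type := {e : Fin 6 × Fin 6 // e.1 < e.2 ∧ octahedron.Adj e.1 e.2}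

/-- The vertices of the augmented octahedron. Each edge `e` of the octahedron carries four copies
of the gadget, numbered by `k : Fin 4`, and each gadget has two sides `s : Fin 2`. -/
inductive AugVertex : Type
  /-- a vertex of the octahedron -/
  | oct (u : Fin 6)
  /-- the subdivision vertex `z_{i+1}` on the path that replaces the edge `e` -/
  | sub (e : OctEdge) (i : Fin 8)
  /-- the central vertex `w` of a gadget -/
  | mid (e : OctEdge) (k : Fin 4)
  /-- the vertex `w_{s+1}` of a gadget -/
  | att (e : OctEdge) (k : Fin 4) (s : Fin 2)
  /-- the vertices of the octahedron of which the loop-subgraph at `w_{s+1}` is a subdivision -/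
  | loop (e : OctEdge) (k : Fin 4) (s : Fin 2) (x : Fin 6)
  deriving DecidableEq, Fintype

/-- The endpoints `v_1`, `v_2` of the four gadgets on an edge are
`z_1, z_6`; `z_2, z_5`; `z_3, z_8`; `z_4, z_7`. -/
def gadgetEnd : Fin 4 → Fin 2 → Fin 8 :=
  ![![0, 5], ![1, 4], ![2, 7], ![3, 6]]

/-- The edges of the augmented octahedron, each listed in one direction. -/
inductive AugEdge : AugVertex → AugVertex → Prop
  /-- the path `u, z_1, …, z_8, v` that replaces the edge `e = (u, v)` -/
  | first (e : OctEdge) : AugEdge (.oct e.1.1) (.sub e 0)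
  | next (e : OctEdge) (i : Fin 7) : AugEdge (.sub e i.castSucc) (.sub e i.succ)
  | last (e : OctEdge) : AugEdge (.sub e 7) (.oct e.1.2)
  /-- the skeleton edges `(v_i, w)`, `(v_i, w_i)`, `(w_i, w)` of a gadget -/
  | endMid (e : OctEdge) (k : Fin 4) (s : Fin 2) : AugEdge (.sub e (gadgetEnd k s)) (.mid e k)
  | endAtt (e : OctEdge) (k : Fin 4) (s : Fin 2) : AugEdge (.sub e (gadgetEnd k s)) (.att e k s)
  | attMid (e : OctEdge) (k : Fin 4) (s : Fin 2) : AugEdge (.att e k s) (.mid e k)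
  /-- the loop-subgraph at `w_i`: an octahedron whose edge `{0, 1}` is subdivided by `w_i` -/
  | attLoopZero (e : OctEdge) (k : Fin 4) (s : Fin 2) : AugEdge (.att e k s) (.loop e k s 0)
  | attLoopOne (e : OctEdge) (k : Fin 4) (s : Fin 2) : AugEdge (.att e k s) (.loop e k s 1)
  | loopLoop (e : OctEdge) (k : Fin 4) (s : Fin 2) (x y : Fin 6)
      (hxy : octahedron.Adj x y) (hne : s(x, y) ≠ s(0, 1)) :
      AugEdge (.loop e k s x) (.loop e k s y)

/-- The augmented octahedron: each edge of the octahedron is replaced by a path with eight inner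
vertices, to which four gadgets are attached. -/
def augmentedOctahedron : SimpleGraph AugVertex := SimpleGraph.fromRel AugEdge

noncomputable instance : DecidableRel augmentedOctahedron.Adj := Classical.decRel _

end CircleSystem

namespace CircleSystem

open Set

/-! ### The parametrization of a circle -/

/-! No realization exists. Every vertex lies on at least two circles, and each circle through it
carries two of its edges, because a simple graph has no loops (`exists_two_edges`). So the four
edges at a vertex split into two pairs, each continuing along one circle. A circle minus a point is
connected, hence a circle with an edge in a loop-subgraph, which hangs on the cut vertex w_i, never
leaves it (`On.loop`). Thus at w_i the edges to v_i and w share a circle. As different circles have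
at most two common points, the two sides of a gadget are two circles, each with exactly the vertices
v_i, w_i, w (`exists_gadget_circles`, `On.mem_triangle`). At every z_i this leaves the two path
edges as the other pair, so the path lies on one circle C, touched at the z_i by eight circles of
which two meet exactly if they belong to the same gadget (`exists_path_circle`).

Invert at the end u of the path. Then C becomes a line, touched at monotone positions t_0, …, t_7 by
circles of signed diameters k_0, …, k_7, and circles i and j meet iff (t_i - t_j)^2 ≤ k_i k_j
(`exists_tangent_parameters`). For two gadgets on the same side of the line, multiplying these
conditions bounds the product of the distances within the pairs by that of distances across them
(`mul_abs_lt_of_tangent_pairs`). Interleaved pairs violate this, so {0,5} and {1,4} lie on one side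
and {2,7} and {3,6} on the other. For these nested pairs the bound forces t_4 - t_1 < t_5 - t_4 and
t_6 - t_3 < t_3 - t_2, which is impossible (`not_four_tangent_pairs`).

Planarity is shown by a straight-line drawing. One integer drawing of a path with its gadgets is
mapped affinely into a thin rhombus around each edge of a plane octahedron. Lines separating
segments, and lines separating rhombi, are verified by computation. -/

/-- The point of the circle `C` at angle `θ`. -/
noncomputable abbrev PlaneCircle.pt (C : PlaneCircle) (θ : ℝ) : ℂ := circleMap C.center C.radius θ

namespace PlaneCircle

variable (C : PlaneCircle)

theorem pt_mem (θ : ℝ) : C.pt θ ∈ C.points :=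
  circleMap_mem_sphere _ C.radius_pos.le _

theorem range_pt : range C.pt = C.points := by
  rw [points, ← abs_of_pos C.radius_pos]
  exact range_circleMap _ _

theorem exists_pt_eq {x : ℂ} (hx : x ∈ C.points) : ∃ θ, C.pt θ = x := by
  rwa [← C.range_pt] at hx

theorem pt_add_int (θ : ℝ) (n : ℤ) : C.pt (θ + n * (2 * Real.pi)) = C.pt θ :=
  (periodic_circleMap C.center C.radius).int_mul n θ

theorem pt_add_two_pi (θ : ℝ) : C.pt (θ + 2 * Real.pi) = C.pt θ :=
  periodic_circleMap C.center C.radius θ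

theorem exists_int_of_pt_eq {a b : ℝ} (h : C.pt a = C.pt b) :
    ∃ n : ℤ, a = b + n * (2 * Real.pi) := by
  obtain ⟨n, hn⟩ := (circleMap_eq_circleMap_iff C.center C.radius_pos.ne').1 h
  refine ⟨n, ?_⟩
  have h2 : ((a : ℂ)) * Complex.I = ((b + n * (2 * Real.pi) : ℝ) : ℂ) * Complex.I := by
    rw [hn]; push_cast; ring
  exact_mod_cast mul_right_cancel₀ Complex.I_ne_zero h2

theorem eq_of_pt_eq {a b : ℝ} (h : C.pt a = C.pt b) (h₁ : a < b + 2 * Real.pi)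
    (h₂ : b < a + 2 * Real.pi) : a = b :=
  eq_of_circleMap_eq C.radius_pos.ne' (by rw [abs_lt]; constructor <;> linarith) h

theorem eq_of_center_eq {C D : PlaneCircle} {x : ℂ} (hC : x ∈ C.points) (hD : x ∈ D.points)
    (h : C.center = D.center) : C = D := by
  have hr : C.radius = D.radius := by
    rw [points, Metric.mem_sphere] at hC hD
    rw [← hC, ← hD, h]
  cases C; cases D; simp_all

/-- Two different circles have at most two common points. -/
theorem eq_of_three_points {C D : PlaneCircle} {x y z : ℂ} (hxy : x ≠ y) (hxz : x ≠ z)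
    (hyz : y ≠ z) (hxC : x ∈ C.points) (hyC : y ∈ C.points) (hzC : z ∈ C.points)
    (hxD : x ∈ D.points) (hyD : y ∈ D.points) (hzD : z ∈ D.points) : C = D := by
  refine eq_of_center_eq hxC hxD (by_contra fun hne => ?_)
  rcases EuclideanGeometry.eq_of_dist_eq_of_dist_eq_of_finrank_eq_two
    Complex.finrank_real_complex hne hxy hxC hyC hzC hxD hyD hzD with h | h
  · exact hxz h.symm
  · exact hyz h.symm

/-- A circle remains connected when a point is removed. -/
theorem isPreconnected_diff_singleton (x : ℂ) : IsPreconnected (C.points \ {x}) := by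
  have hcont : Continuous C.pt := continuous_circleMap _ _
  by_cases hx : x ∈ C.points
  · obtain ⟨θ, rfl⟩ := C.exists_pt_eq hx
    have : C.points \ {C.pt θ} = C.pt '' Ioo θ (θ + 2 * Real.pi) := by
      ext y
      constructor
      · rintro ⟨hy, hne⟩
        obtain ⟨t, ht⟩ := C.exists_pt_eq hy
        obtain ⟨s, hs, hst⟩ :=
          (periodic_circleMap C.center C.radius).exists_mem_Ico Real.two_pi_pos t θ
        have hst : C.pt t = C.pt s := hst
        refine ⟨s, ⟨lt_of_le_of_ne hs.1 ?_, hs.2⟩, hst.symm.trans ht⟩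
        rintro rfl
        exact hne (ht.symm.trans hst)
      · rintro ⟨t, ht, rfl⟩
        refine ⟨C.pt_mem t, fun h => ?_⟩
        have := C.eq_of_pt_eq (mem_singleton_iff.1 h) (by linarith [ht.2])
          (by linarith [ht.1, Real.two_pi_pos])
        linarith [ht.1]
    rw [this]
    exact isPreconnected_Ioo.image _ hcont.continuousOn
  · rw [sdiff_singleton_eq_self hx, ← C.range_pt]
    exact isPreconnected_range hcont

end PlaneCircle

/-! ### Arcs between consecutive meeting points -/

section Arcs

variable {S : Finset PlaneCircle}

theorem circle_unique_of_notMem_meetingPoints {C D : PlaneCircle} (hC : C ∈ S) (hD : D ∈ S) {x : ℂ}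
    (hx : x ∉ meetingPoints S) (hxC : x ∈ C.points) (hxD : x ∈ D.points) : C = D := by
  by_contra hne
  exact hx ⟨C, hC, D, hD, hne, hxC, hxD⟩

/-- The ends can be recovered from the point set of the arc alone, so two descriptions of the same
set as an arc have the same ends. -/
theorem IsCircularArc.mem_ends_iff {A : Set ℂ} {ends : Sym2 ℂ} (h : IsCircularArc S A ends)
    (x : ℂ) : x ∈ ends ↔ x ∈ A ∧ x ∈ meetingPoints S := by
  obtain ⟨C, hC, a, b, hab, -, rfl, rfl, ha, hb, hno⟩ := h
  rw [Sym2.mem_iff]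
  constructor
  · rintro (rfl | rfl)
    · exact ⟨⟨a, ⟨le_rfl, hab.le⟩, rfl⟩, ha⟩
    · exact ⟨⟨b, ⟨hab.le, le_rfl⟩, rfl⟩, hb⟩
  · rintro ⟨⟨t, ht, rfl⟩, hx⟩
    rcases eq_or_lt_of_le ht.1 with rfl | h1
    · exact Or.inl rfl
    rcases eq_or_lt_of_le ht.2 with rfl | h2
    · exact Or.inr rfl
    exact absurd hx (hno t ⟨h1, h2⟩)

theorem finite_meeting_angles (hfin : (meetingPoints S).Finite) (C : PlaneCircle) (a b : ℝ) :
    {t ∈ Icc a b | C.pt t ∈ meetingPoints S}.Finite := by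
  obtain ⟨N, hN⟩ := exists_nat_gt ((b - a) / (2 * Real.pi))
  have hN : b < a + N * (2 * Real.pi) := by
    rw [div_lt_iff₀ Real.two_pi_pos] at hN; linarith
  -- The interval is cut into half-open periods, on each of which `C.pt` is injective.
  have hsub : {t ∈ Icc a b | C.pt t ∈ meetingPoints S} ⊆
      ⋃ k ∈ Finset.range N, {t ∈ Ico (a + k * (2 * Real.pi)) (a + k * (2 * Real.pi) + 2 * Real.pi) |
        C.pt t ∈ meetingPoints S} := by
    rintro t ⟨ht, hm⟩
    have h0 : 0 ≤ (t - a) / (2 * Real.pi) := div_nonneg (by linarith [ht.1]) Real.two_pi_pos.le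
    have h1 := Nat.floor_le h0
    have h2 := Nat.lt_floor_add_one ((t - a) / (2 * Real.pi))
    rw [le_div_iff₀ Real.two_pi_pos] at h1
    rw [div_lt_iff₀ Real.two_pi_pos] at h2
    simp only [mem_iUnion]
    refine ⟨⌊(t - a) / (2 * Real.pi)⌋₊, Finset.mem_range.2 ?_, ⟨by linarith, by linarith⟩, hm⟩
    rw [Nat.floor_lt h0, div_lt_iff₀ Real.two_pi_pos]
    linarith [ht.2]
  refine Set.Finite.subset (Set.Finite.biUnion (Finset.finite_toSet _) fun k _ => ?_) hsub
  refine Set.Finite.of_finite_image (f := C.pt) (hfin.subset ?_) ?_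
  · rintro _ ⟨t, ht, rfl⟩; exact ht.2
  · intro s hs t ht h
    exact C.eq_of_pt_eq h (by linarith [hs.1.2, ht.1.1]) (by linarith [ht.1.2, hs.1.1])

theorem exists_next_meeting_angle (hfin : (meetingPoints S).Finite) (C : PlaneCircle) {θ₀ : ℝ}
    (h₀ : C.pt θ₀ ∈ meetingPoints S) (t : ℝ) :
    ∃ b, t < b ∧ b ≤ t + 2 * Real.pi ∧ C.pt b ∈ meetingPoints S ∧
      ∀ s ∈ Ioo t b, C.pt s ∉ meetingPoints S := by
  have hf : {s ∈ Ioc t (t + 2 * Real.pi) | C.pt s ∈ meetingPoints S}.Finite :=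
    (finite_meeting_angles hfin C t (t + 2 * Real.pi)).subset
      fun s hs => ⟨Ioc_subset_Icc_self hs.1, hs.2⟩
  have hne : {s ∈ Ioc t (t + 2 * Real.pi) | C.pt s ∈ meetingPoints S}.Nonempty := by
    obtain ⟨s, hs, hst⟩ :=
      (periodic_circleMap C.center C.radius).exists_mem_Ioc Real.two_pi_pos θ₀ t
    exact ⟨s, hs, by rw [PlaneCircle.pt, ← hst]; exact h₀⟩
  obtain ⟨b, hb, hmin⟩ := Set.exists_min_image _ id hf hne
  refine ⟨b, hb.1.1, hb.1.2, hb.2, fun s hs hm => ?_⟩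
  have := hmin s ⟨⟨hs.1, by linarith [hs.2, hb.1.2]⟩, hm⟩
  exact absurd hs.2 (not_lt.2 this)

theorem exists_prev_meeting_angle (hfin : (meetingPoints S).Finite) (C : PlaneCircle) {θ₀ : ℝ}
    (h₀ : C.pt θ₀ ∈ meetingPoints S) (t : ℝ) :
    ∃ a, a < t ∧ t ≤ a + 2 * Real.pi ∧ C.pt a ∈ meetingPoints S ∧
      ∀ s ∈ Ioo a t, C.pt s ∉ meetingPoints S := by
  have hf : {s ∈ Ico (t - 2 * Real.pi) t | C.pt s ∈ meetingPoints S}.Finite :=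
    (finite_meeting_angles hfin C (t - 2 * Real.pi) t).subset
      fun s hs => ⟨Ico_subset_Icc_self hs.1, hs.2⟩
  have hne : {s ∈ Ico (t - 2 * Real.pi) t | C.pt s ∈ meetingPoints S}.Nonempty := by
    obtain ⟨s, hs, hst⟩ := (periodic_circleMap C.center C.radius).exists_mem_Ico
      Real.two_pi_pos θ₀ (t - 2 * Real.pi)
    rw [sub_add_cancel] at hs
    exact ⟨s, hs, by rw [PlaneCircle.pt, ← hst]; exact h₀⟩
  obtain ⟨a, ha, hmax⟩ := Set.exists_max_image _ id hf hne
  refine ⟨a, ha.1.2, by linarith [ha.1.1], ha.2, fun s hs hm => ?_⟩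
  have := hmax s ⟨⟨by linarith [hs.1, ha.1.1], hs.2⟩, hm⟩
  exact absurd hs.1 (not_lt.2 this)

/-- The arcs on a circle with a meeting point cover the circle. -/
theorem exists_arc_through (hfin : (meetingPoints S).Finite) {C : PlaneCircle} (hC : C ∈ S)
    {x y : ℂ} (hxC : x ∈ C.points) (hx : x ∈ meetingPoints S) (hy : y ∈ C.points) :
    ∃ A ends, IsCircularArc S A ends ∧ A ⊆ C.points ∧ y ∈ A := by
  obtain ⟨θ₀, rfl⟩ := C.exists_pt_eq hxC
  obtain ⟨t, rfl⟩ := C.exists_pt_eq hy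
  obtain ⟨b, htb, hb2, hb, hnb⟩ := exists_next_meeting_angle hfin C hx t
  by_cases ht : C.pt t ∈ meetingPoints S
  · refine ⟨_, _, ⟨C, hC, t, b, htb, hb2, rfl, rfl, ht, hb, hnb⟩, ?_, ⟨t, ⟨le_rfl, htb.le⟩, rfl⟩⟩
    rintro _ ⟨s, -, rfl⟩; exact C.pt_mem s
  · obtain ⟨a, hat, ha2, ha, hna⟩ := exists_prev_meeting_angle hfin C hx t
    refine ⟨_, _, ⟨C, hC, a, b, hat.trans htb, ?_, rfl, rfl, ha, hb, ?_⟩, ?_,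
      ⟨t, ⟨hat.le, htb.le⟩, rfl⟩⟩
    -- If the arc were longer than a full turn, the meeting angle `a + 2 * Real.pi` would equal `t`
    -- or lie between `t` and `b`.
    · by_contra! hlt
      rw [← C.pt_add_two_pi] at ha
      rcases eq_or_lt_of_le ha2 with h | h
      · exact ht (h ▸ ha)
      · exact hnb _ ⟨h, hlt⟩ ha
    · intro s hs
      rcases lt_trichotomy s t with h | rfl | h
      · exact hna s ⟨hs.1, h⟩
      · exact ht
      · exact hnb s ⟨h, hs.2⟩
    · rintro _ ⟨s, -, rfl⟩; exact C.pt_mem s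

/-- Two arcs on the same circle that have a common point which is not a meeting point agree. -/
theorem arc_eq_of_common_point {C : PlaneCircle} {a b a' b' : ℝ}
    (ha : C.pt a ∈ meetingPoints S) (hb : C.pt b ∈ meetingPoints S)
    (hno : ∀ t ∈ Ioo a b, C.pt t ∉ meetingPoints S)
    (ha' : C.pt a' ∈ meetingPoints S) (hb' : C.pt b' ∈ meetingPoints S)
    (hno' : ∀ t ∈ Ioo a' b', C.pt t ∉ meetingPoints S) {y : ℂ} (hy : y ∉ meetingPoints S)
    (hyA : y ∈ C.pt '' Icc a b) (hyA' : y ∈ C.pt '' Icc a' b') :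
    C.pt '' Icc a b = C.pt '' Icc a' b' := by
  obtain ⟨t, ht, rfl⟩ := hyA
  obtain ⟨t', ht', htt'⟩ := hyA'
  obtain ⟨n, hn⟩ := C.exists_int_of_pt_eq htt'
  have h1 : a < t := lt_of_le_of_ne ht.1 fun h => hy (h ▸ ha)
  have h2 : t < b := lt_of_le_of_ne ht.2 fun h => hy (h ▸ hb)
  have h3 : a' < t' := lt_of_le_of_ne ht'.1 fun h => hy (htt' ▸ h ▸ ha')
  have h4 : t' < b' := lt_of_le_of_ne ht'.2 fun h => hy (htt' ▸ h ▸ hb')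
  -- After a shift by `n` turns both intervals contain `t'`. If an end differed, one interval would
  -- have an end of the other in its interior.
  have e1 : a' = a + n * (2 * Real.pi) := by
    rcases lt_trichotomy a' (a + n * (2 * Real.pi)) with h | h | h
    · exact absurd (by rwa [C.pt_add_int]) (hno' _ ⟨h, by linarith⟩)
    · exact h
    · refine absurd ?_ (hno (a' - n * (2 * Real.pi)) ⟨by linarith, by linarith⟩)
      rwa [← C.pt_add_int _ n, sub_add_cancel]
  have e2 : b' = b + n * (2 * Real.pi) := by
    rcases lt_trichotomy b' (b + n * (2 * Real.pi)) with h | h | h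
    · refine absurd ?_ (hno (b' - n * (2 * Real.pi)) ⟨by linarith, by linarith⟩)
      rwa [← C.pt_add_int _ n, sub_add_cancel]
    · exact h
    · exact absurd (by rwa [C.pt_add_int]) (hno' _ ⟨by linarith, h⟩)
  subst e1 e2
  ext z
  constructor
  · rintro ⟨s, hs, rfl⟩
    exact ⟨s + n * (2 * Real.pi), ⟨by linarith [hs.1], by linarith [hs.2]⟩, C.pt_add_int _ _⟩
  · rintro ⟨s, hs, rfl⟩
    refine ⟨s - n * (2 * Real.pi), ⟨by linarith [hs.1], by linarith [hs.2]⟩, ?_⟩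
    rw [← C.pt_add_int _ n, sub_add_cancel]

/-- The arcs before and after a meeting point differ, unless the circle is a single loop. -/
theorem arc_before_ne_arc_after {C : PlaneCircle} {a t b : ℝ} (htb : t < b)
    (hta : t < a + 2 * Real.pi) (ha : C.pt a ∈ meetingPoints S)
    (hno : ∀ s ∈ Ioo t b, C.pt s ∉ meetingPoints S) :
    C.pt '' Icc a t ≠ C.pt '' Icc t b := by
  intro h
  -- An angle of the first arc must represent this interior point of the second one after at least
  -- one full turn, which puts the meeting angle `a + 2 * Real.pi` strictly between `t` and `b`.
  have hm : C.pt ((t + b) / 2) ∈ C.pt '' Icc a t :=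
    h ▸ ⟨(t + b) / 2, ⟨by linarith, by linarith⟩, rfl⟩
  obtain ⟨s, hs, hsm⟩ := hm
  obtain ⟨n, hn⟩ := C.exists_int_of_pt_eq hsm.symm
  have hn1 : (1 : ℝ) ≤ n := by
    have : (0 : ℝ) < n * (2 * Real.pi) := by linarith [hs.2]
    have := pos_of_mul_pos_left this Real.two_pi_pos.le
    exact_mod_cast this
  have : 2 * Real.pi ≤ n * (2 * Real.pi) := le_mul_of_one_le_left Real.two_pi_pos.le hn1
  refine hno (a + 2 * Real.pi) ⟨hta, by linarith [hs.1]⟩ ?_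
  rwa [C.pt_add_two_pi]

end Arcs

/-! ### Realizations as systems of circles -/

/-- A realization of `G` as a system of circles. -/
structure CircleRealization {V : Type*} (G : SimpleGraph V) where
  S : Finset PlaneCircle
  p : V → ℂ
  arc : Sym2 V → Set ℂ
  p_injective : Function.Injective p
  range_p : range p = meetingPoints S
  isCircularArc : ∀ e ∈ G.edgeSet, IsCircularArc S (arc e) (e.map p)
  bijOn : BijOn arc G.edgeSet {A | ∃ ends, IsCircularArc S A ends}

namespace CircleRealization

variable {V : Type*} {G : SimpleGraph V} (R : CircleRealization G)

theorem p_mem_meetingPoints (v : V) : R.p v ∈ meetingPoints R.S :=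
  R.range_p ▸ mem_range_self v

theorem exists_p_eq {x : ℂ} (hx : x ∈ meetingPoints R.S) : ∃ v, R.p v = x := by
  rwa [← R.range_p] at hx

theorem finite_meetingPoints [Finite V] : (meetingPoints R.S).Finite :=
  R.range_p ▸ finite_range R.p

/-- The circle that contains the arc of an edge. -/
noncomputable def circ (e : G.edgeSet) : PlaneCircle := (R.isCircularArc e e.2).choose

theorem circ_mem (e : G.edgeSet) : R.circ e ∈ R.S := (R.isCircularArc e e.2).choose_spec.1

theorem arc_eq (e : G.edgeSet) : ∃ a b : ℝ, a < b ∧ b ≤ a + 2 * Real.pi ∧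
    R.arc e = (R.circ e).pt '' Icc a b ∧
    (e : Sym2 V).map R.p = s((R.circ e).pt a, (R.circ e).pt b) ∧
    (R.circ e).pt a ∈ meetingPoints R.S ∧ (R.circ e).pt b ∈ meetingPoints R.S ∧
    ∀ t ∈ Ioo a b, (R.circ e).pt t ∉ meetingPoints R.S :=
  (R.isCircularArc e e.2).choose_spec.2

theorem arc_subset (e : G.edgeSet) : R.arc e ⊆ (R.circ e).points := by
  obtain ⟨a, b, -, -, h, -⟩ := R.arc_eq e
  rw [h]
  rintro _ ⟨t, -, rfl⟩
  exact (R.circ e).pt_mem t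

theorem exists_mem_arc_notMem_meetingPoints (e : G.edgeSet) :
    ∃ x ∈ R.arc e, x ∉ meetingPoints R.S := by
  obtain ⟨a, b, hab, -, h, -, -, -, hno⟩ := R.arc_eq e
  rw [h]
  exact ⟨_, ⟨(a + b) / 2, ⟨by linarith, by linarith⟩, rfl⟩, hno _ ⟨by linarith, by linarith⟩⟩

/-- An interior point of the arc is no meeting point, hence lies on only one circle of the system.
-/
theorem circ_eq_of_arc_subset (e : G.edgeSet) {C : PlaneCircle} (hC : C ∈ R.S)
    (h : R.arc e ⊆ C.points) : R.circ e = C := by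
  obtain ⟨x, hx, hxm⟩ := R.exists_mem_arc_notMem_meetingPoints e
  exact circle_unique_of_notMem_meetingPoints (R.circ_mem e) hC hxm (R.arc_subset e hx) (h hx)

theorem p_mem_arc_iff (e : G.edgeSet) (v : V) : R.p v ∈ R.arc e ↔ v ∈ (e : Sym2 V) := by
  have h := (R.isCircularArc e e.2).mem_ends_iff (R.p v)
  rw [← and_iff_left (a := R.p v ∈ R.arc e) (R.p_mem_meetingPoints v), ← h, Sym2.mem_map]
  constructor
  · rintro ⟨w, hw, hwv⟩; exact R.p_injective hwv ▸ hw
  · intro hv; exact ⟨v, hv, rfl⟩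

theorem p_mem_circ (e : G.edgeSet) {v : V} (hv : v ∈ (e : Sym2 V)) : R.p v ∈ (R.circ e).points :=
  R.arc_subset e ((R.p_mem_arc_iff e v).2 hv)

theorem exists_edge {A : Set ℂ} {ends : Sym2 ℂ} (h : IsCircularArc R.S A ends) :
    ∃ e : G.edgeSet, R.arc e = A := by
  obtain ⟨e, he, rfl⟩ := R.bijOn.surjOn ⟨ends, h⟩
  exact ⟨⟨e, he⟩, rfl⟩

theorem edge_eq_of_arc_eq {e f : G.edgeSet} (h : R.arc e = R.arc f) : e = f :=
  Subtype.ext (R.bijOn.injOn e.2 f.2 h)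

/-- Every arc is the arc of an edge, and a simple graph has no loops. So no arc winds once around a
whole circle. -/
theorem ends_not_isDiag {A : Set ℂ} {ends : Sym2 ℂ} (h : IsCircularArc R.S A ends) :
    ¬ ends.IsDiag := by
  obtain ⟨e, rfl⟩ := R.exists_edge h
  have hee : ends = (e : Sym2 V).map R.p := Sym2.ext fun x => by
    rw [h.mem_ends_iff, (R.isCircularArc e e.2).mem_ends_iff]
  rw [hee, Sym2.isDiag_map R.p_injective]
  exact G.not_isDiag_of_mem_edgeSet e.2

/-- Two different edges on the same circle have only common end points. -/
theorem exists_vertex_of_mem_arc {e f : G.edgeSet} (hne : e ≠ f) (hc : R.circ e = R.circ f) {y : ℂ}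
    (hye : y ∈ R.arc e) (hyf : y ∈ R.arc f) :
    ∃ v, R.p v = y ∧ v ∈ (e : Sym2 V) ∧ v ∈ (f : Sym2 V) := by
  have hy : y ∈ meetingPoints R.S := by
    by_contra hy
    obtain ⟨a, b, -, -, h, -, ha, hb, hno⟩ := R.arc_eq e
    obtain ⟨a', b', -, -, h', -, ha', hb', hno'⟩ := R.arc_eq f
    rw [← hc] at h' ha' hb' hno'
    refine hne (R.edge_eq_of_arc_eq ?_)
    rw [h, h']
    exact arc_eq_of_common_point ha hb hno ha' hb' hno' hy (h ▸ hye) (h' ▸ hyf)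
  obtain ⟨v, rfl⟩ := R.exists_p_eq hy
  exact ⟨v, rfl, (R.p_mem_arc_iff e v).1 hye, (R.p_mem_arc_iff f v).1 hyf⟩

/-- Each circle through a vertex contains two edges at this vertex. -/
theorem exists_two_edges [Finite V] {C : PlaneCircle} (hC : C ∈ R.S) {v : V}
    (hv : R.p v ∈ C.points) : ∃ e f : G.edgeSet, e ≠ f ∧ v ∈ (e : Sym2 V) ∧ v ∈ (f : Sym2 V) ∧
      R.circ e = C ∧ R.circ f = C := by
  obtain ⟨t, ht⟩ := C.exists_pt_eq hv
  have hm : C.pt t ∈ meetingPoints R.S := ht ▸ R.p_mem_meetingPoints v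
  have hsub : ∀ a b, C.pt '' Icc a b ⊆ C.points := by
    rintro a b _ ⟨s, -, rfl⟩; exact C.pt_mem s
  obtain ⟨b, htb, hb2, hb, hnb⟩ := exists_next_meeting_angle R.finite_meetingPoints C hm t
  obtain ⟨a, hat, ha2, ha, hna⟩ := exists_prev_meeting_angle R.finite_meetingPoints C hm t
  have hA : IsCircularArc R.S (C.pt '' Icc a t) s(C.pt a, C.pt t) :=
    ⟨C, hC, a, t, hat, ha2, rfl, rfl, ha, hm, hna⟩
  have hB : IsCircularArc R.S (C.pt '' Icc t b) s(C.pt t, C.pt b) :=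
    ⟨C, hC, t, b, htb, hb2, rfl, rfl, hm, hb, hnb⟩
  have hta : t < a + 2 * Real.pi := by
    refine lt_of_le_of_ne ha2 fun h => R.ends_not_isDiag hA ?_
    rw [Sym2.mk_isDiag_iff, h, C.pt_add_two_pi]
  obtain ⟨e, he⟩ := R.exists_edge hA
  obtain ⟨f, hf⟩ := R.exists_edge hB
  refine ⟨e, f, ?_, ?_, ?_, ?_, ?_⟩
  · rintro rfl
    exact arc_before_ne_arc_after htb hta ha hnb (he.symm.trans hf)
  · rw [← R.p_mem_arc_iff, he, ← ht]; exact ⟨t, ⟨hat.le, le_rfl⟩, rfl⟩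
  · rw [← R.p_mem_arc_iff, hf, ← ht]; exact ⟨t, ⟨le_rfl, htb.le⟩, rfl⟩
  · exact R.circ_eq_of_arc_subset e hC (he ▸ hsub _ _)
  · exact R.circ_eq_of_arc_subset f hC (hf ▸ hsub _ _)

/-- Each edge at a vertex has a second edge at this vertex on the same circle. -/
theorem exists_partner [Finite V] (e : G.edgeSet) {v : V} (hv : v ∈ (e : Sym2 V)) :
    ∃ f : G.edgeSet, f ≠ e ∧ v ∈ (f : Sym2 V) ∧ R.circ f = R.circ e := by
  obtain ⟨f, g, hfg, hf, hg, hcf, hcg⟩ := R.exists_two_edges (R.circ_mem e) (R.p_mem_circ e hv)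
  by_cases h : f = e
  · exact ⟨g, fun h' => hfg (h.trans h'.symm), hg, hcg⟩
  · exact ⟨f, h, hf, hcf⟩

/-- In a graph of maximum degree four, no three edges at a vertex lie on the same circle. -/
theorem not_three_edges [Fintype V] [DecidableRel G.Adj] {v : V} (hdeg : G.degree v ≤ 4)
    {e f g : G.edgeSet} (hef : e ≠ f) (heg : e ≠ g) (hfg : f ≠ g) (he : v ∈ (e : Sym2 V))
    (hf : v ∈ (f : Sym2 V)) (hg : v ∈ (g : Sym2 V)) (h₁ : R.circ f = R.circ e)
    (h₂ : R.circ g = R.circ e) : False := by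
  classical
  obtain ⟨C, hC, D, hD, hCD, hvC, hvD⟩ := R.p_mem_meetingPoints v
  -- A second circle through the vertex contributes two further edges, which would make five.
  obtain ⟨E, hE, hne, hvE⟩ : ∃ E ∈ R.S, R.circ e ≠ E ∧ R.p v ∈ E.points := by
    by_cases h : R.circ e = C
    · exact ⟨D, hD, fun h' => hCD (h.symm.trans h'), hvD⟩
    · exact ⟨C, hC, h, hvC⟩
  obtain ⟨x, y, hxy, hx, hy, hxE, hyE⟩ := R.exists_two_edges hE hvE
  have hne' : ∀ a b : G.edgeSet, R.circ a = R.circ e → R.circ b = E → a ≠ b := by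
    rintro a b ha hb rfl; exact hne (ha.symm.trans hb)
  have hsub : ({(e : Sym2 V), (f : Sym2 V), (g : Sym2 V), (x : Sym2 V), (y : Sym2 V)} :
      Finset (Sym2 V)) ⊆ G.incidenceFinset v := by
    intro z hz
    simp only [Finset.mem_insert, Finset.mem_singleton] at hz
    rw [SimpleGraph.mem_incidenceFinset]
    rcases hz with rfl | rfl | rfl | rfl | rfl
    exacts [⟨e.2, he⟩, ⟨f.2, hf⟩, ⟨g.2, hg⟩, ⟨x.2, hx⟩, ⟨y.2, hy⟩]
  have hcard := Finset.card_le_card hsub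
  rw [SimpleGraph.card_incidenceFinset_eq_degree] at hcard
  have h5 : ({(e : Sym2 V), (f : Sym2 V), (g : Sym2 V), (x : Sym2 V), (y : Sym2 V)} :
      Finset (Sym2 V)).card = 5 := by
    have c : ∀ {a b : G.edgeSet}, a ≠ b → (a : Sym2 V) ≠ b := fun h h' => h (Subtype.ext h')
    rw [Finset.card_insert_of_notMem, Finset.card_insert_of_notMem, Finset.card_insert_of_notMem,
      Finset.card_insert_of_notMem, Finset.card_singleton]
    · simpa using c hxy
    · simpa using ⟨c (hne' g x h₂ hxE), c (hne' g y h₂ hyE)⟩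
    · simpa using ⟨c hfg, c (hne' f x h₁ hxE), c (hne' f y h₁ hyE)⟩
    · simpa using ⟨c hef, c heg, c (hne' e x rfl hxE), c (hne' e y rfl hyE)⟩
  omega

/-- A set of edges that contains, with each of its edges, the edges on the same circle that share
a vertex other than `x` with it contains all edges of each circle that it meets. -/
theorem mem_of_circ_eq [Finite V] (x : V) (X : Set G.edgeSet)
    (hX : ∀ e ∈ X, ∀ f, R.circ f = R.circ e → ∀ v, v ≠ x → v ∈ (e : Sym2 V) →
      v ∈ (f : Sym2 V) → f ∈ X)
    {e f : G.edgeSet} (he : e ∈ X) (hf : R.circ f = R.circ e) : f ∈ X := by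
  by_contra hfX
  -- The arcs of the circle in `X` and those outside `X` form two closed sets covering the circle
  -- minus `R.p x`. By connectedness they share a point other than `R.p x`, which is a common vertex
  -- of an edge in `X` and one outside.
  let U : Set G.edgeSet → Set ℂ := fun Z => ⋃ g ∈ {g | g ∈ Z ∧ R.circ g = R.circ e}, R.arc g
  have hclosed : ∀ Z, IsClosed (U Z) := by
    intro Z
    refine Set.Finite.isClosed_biUnion (Set.toFinite _) fun g _ => ?_
    obtain ⟨a, b, -, -, h, -⟩ := R.arc_eq g
    rw [h]
    exact (isCompact_Icc.image (continuous_circleMap _ _)).isClosed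
  have hmem : ∀ Z (g : G.edgeSet), g ∈ Z → R.circ g = R.circ e →
      (((R.circ e).points \ {R.p x}) ∩ U Z).Nonempty := by
    intro Z g hg hc
    obtain ⟨y, hy, hym⟩ := R.exists_mem_arc_notMem_meetingPoints g
    refine ⟨y, ⟨hc ▸ R.arc_subset g hy, ?_⟩, mem_biUnion (⟨hg, hc⟩ : _ ∧ _) hy⟩
    rintro rfl
    exact hym (R.p_mem_meetingPoints x)
  have hcover : (R.circ e).points \ {R.p x} ⊆ U X ∪ U Xᶜ := by
    rintro y ⟨hy, -⟩
    obtain ⟨v, hv⟩ : ∃ v, v ∈ (e : Sym2 V) := ⟨_, (e : Sym2 V).out_fst_mem⟩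
    obtain ⟨A, ends, hA, hAC, hyA⟩ := exists_arc_through R.finite_meetingPoints (R.circ_mem e)
      (R.p_mem_circ e hv) (R.p_mem_meetingPoints v) hy
    obtain ⟨g, rfl⟩ := R.exists_edge hA
    have hc := R.circ_eq_of_arc_subset g (R.circ_mem e) hAC
    by_cases hg : g ∈ X
    · exact Or.inl (mem_biUnion (⟨hg, hc⟩ : _ ∧ _) hyA)
    · exact Or.inr (mem_biUnion (⟨hg, hc⟩ : _ ∧ _) hyA)
  obtain ⟨y, ⟨-, hyx⟩, hyX, hyX'⟩ := isPreconnected_closed_iff.1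
    ((R.circ e).isPreconnected_diff_singleton (R.p x)) _ _ (hclosed X) (hclosed Xᶜ) hcover
    (hmem X e he rfl) (hmem Xᶜ f hfX hf)
  obtain ⟨g, ⟨hg, hgc⟩, hyg⟩ := mem_iUnion₂.1 hyX
  obtain ⟨g', ⟨hg', hgc'⟩, hyg'⟩ := mem_iUnion₂.1 hyX'
  obtain ⟨v, rfl, hv, hv'⟩ := R.exists_vertex_of_mem_arc (by rintro rfl; exact hg' hg)
    (hgc.trans hgc'.symm) hyg hyg'
  exact hg' (hX g hg g' (hgc'.trans hgc.symm) v (fun h => hyx (by rw [h]; rfl)) hv hv')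

end CircleRealization

/-! ### Circles tangent to a fixed circle -/

namespace PlaneCircle

theorem mem_points_iff_normSq (C : PlaneCircle) (x : ℂ) :
    x ∈ C.points ↔ Complex.normSq (x - C.center) = C.radius ^ 2 := by
  rw [points, Metric.mem_sphere, dist_eq_norm, Complex.normSq_eq_norm_sq,
    sq_eq_sq₀ (norm_nonneg _) C.radius_pos.le]

/-- Two circles meet if and only if their radii and the distance of their centers satisfy the
triangle inequalities. -/
theorem inter_nonempty_iff (C D : PlaneCircle) :
    (C.points ∩ D.points).Nonempty ↔
      (Complex.normSq (D.center - C.center) - (C.radius - D.radius) ^ 2) *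
        (Complex.normSq (D.center - C.center) - (C.radius + D.radius) ^ 2) ≤ 0 := by
  have hC := C.radius_pos
  have hD := D.radius_pos
  constructor
  · rintro ⟨x, hxC, hxD⟩
    rw [points, Metric.mem_sphere] at hxC hxD
    have h1 : dist D.center C.center ≤ D.radius + C.radius := by
      rw [← hxC, ← hxD]; exact dist_triangle_left _ _ _
    have h2 : |C.radius - D.radius| ≤ dist D.center C.center := by
      rw [← hxC, ← hxD, dist_comm D.center, dist_comm x, dist_comm x]
      exact abs_dist_sub_le _ _ _
    rw [Complex.normSq_eq_norm_sq, ← dist_eq_norm]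
    refine mul_nonpos_of_nonneg_of_nonpos ?_ ?_
    · rw [sub_nonneg, ← sq_abs]; exact pow_le_pow_left₀ (abs_nonneg _) h2 2
    · rw [sub_nonpos]; exact pow_le_pow_left₀ dist_nonneg (by linarith) 2
  · intro h
    by_cases hc : D.center = C.center
    · rw [hc, sub_self, map_zero] at h
      have h1 : (C.radius - D.radius) ^ 2 * (C.radius + D.radius) ^ 2 ≤ 0 := by linarith
      have h2 : (C.radius - D.radius) ^ 2 ≤ 0 := nonpos_of_mul_nonpos_left h1 (by positivity)
      have h3 : C.radius = D.radius := by
        have := pow_eq_zero_iff (two_ne_zero) |>.1 (le_antisymm h2 (sq_nonneg _))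
        linarith
      refine ⟨C.pt 0, C.pt_mem 0, ?_⟩
      rw [points, hc, ← h3]
      exact C.pt_mem 0
    · set N := Complex.normSq (D.center - C.center) with hN
      have hNpos : 0 < N := Complex.normSq_pos.2 (sub_ne_zero.2 hc)
      -- In the frame in which `D.center - C.center` is the unit, `α` is the foot of the common
      -- point on the line of centers and `β` below its height. By Heron's formula, the hypothesis
      -- says that the squared height is nonnegative.
      set α : ℝ := (N + C.radius ^ 2 - D.radius ^ 2) / (2 * N) with hα
      have hβ : 0 ≤ C.radius ^ 2 / N - α ^ 2 := by
        have : C.radius ^ 2 / N - α ^ 2 = -((N - (C.radius - D.radius) ^ 2) *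
            (N - (C.radius + D.radius) ^ 2)) / (4 * N ^ 2) := by
          rw [hα]; field_simp; ring
        rw [this]
        exact div_nonneg (by linarith) (by positivity)
      set β : ℝ := √(C.radius ^ 2 / N - α ^ 2) with hβdef
      have hβsq : β ^ 2 = C.radius ^ 2 / N - α ^ 2 := Real.sq_sqrt hβ
      have hN1 : C.radius ^ 2 / N * N = C.radius ^ 2 := div_mul_cancel₀ _ hNpos.ne'
      have hN2 : α * (2 * N) = N + C.radius ^ 2 - D.radius ^ 2 :=
        div_mul_cancel₀ _ (by positivity)
      refine ⟨C.center + (D.center - C.center) * ⟨α, β⟩, ?_, ?_⟩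
      · rw [mem_points_iff_normSq, add_sub_cancel_left, map_mul, ← hN, Complex.normSq_mk]
        linear_combination hN1 + N * hβsq
      · have : C.center + (D.center - C.center) * ⟨α, β⟩ - D.center =
            (D.center - C.center) * ⟨α - 1, β⟩ := by
          have : (⟨α - 1, β⟩ : ℂ) = ⟨α, β⟩ - 1 := by apply Complex.ext <;> simp
          rw [this]; ring
        rw [mem_points_iff_normSq, this, map_mul, ← hN, Complex.normSq_mk]
        linear_combination hN1 + N * hβsq - hN2

/-- The center of a circle that touches `C` at `z` lies on the line through `z` and the center
of `C`. -/
theorem exists_ratio_of_tangent {C D : PlaneCircle} {z : ℂ} (hne : C ≠ D)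
    (h : C.points ∩ D.points = {z}) :
    ∃ ρ : ℝ, ρ ≠ 1 ∧ D.center = C.center + (1 - ρ : ℝ) * (z - C.center) ∧
      D.radius = |ρ| * C.radius := by
  have hz : z ∈ C.points ∩ D.points := h ▸ mem_singleton z
  have hzC := (C.mem_points_iff_normSq z).1 hz.1
  have hzD := (D.mem_points_iff_normSq z).1 hz.2
  have hc : D.center - C.center ≠ 0 := fun h0 =>
    hne (eq_of_center_eq hz.1 hz.2 (sub_eq_zero.1 h0).symm)
  obtain ⟨w, hw⟩ : ∃ w, z - C.center = (D.center - C.center) * w :=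
    ⟨(z - C.center) / (D.center - C.center), by field_simp⟩
  -- Reflection in the line of centers preserves both circles, so it fixes their only common point,
  -- and `w` is real.
  have hzw : C.center + (D.center - C.center) * (starRingEnd ℂ) w ∈ C.points ∩ D.points := by
    constructor
    · rw [mem_points_iff_normSq, add_sub_cancel_left, map_mul, Complex.normSq_conj, ← map_mul,
        ← hw, hzC]
    · have h1 : C.center + (D.center - C.center) * (starRingEnd ℂ) w - D.center =
          (D.center - C.center) * (starRingEnd ℂ) (w - 1) := by
        rw [map_sub, map_one]; ring
      have h2 : z - D.center = (D.center - C.center) * (w - 1) := by linear_combination hw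
      rw [mem_points_iff_normSq, h1, map_mul, Complex.normSq_conj, ← map_mul, ← h2, hzD]
  rw [h, mem_singleton_iff] at hzw
  have hreal : (starRingEnd ℂ) w = w := by
    apply mul_left_cancel₀ hc
    rw [← hw, ← hzw]; ring
  obtain ⟨x, rfl⟩ := Complex.conj_eq_iff_real.1 hreal
  have hx : x ≠ 0 := by
    rintro rfl
    rw [hw] at hzC
    have := pow_pos C.radius_pos 2
    simp only [Complex.ofReal_zero, mul_zero, map_zero] at hzC
    exact this.ne hzC
  have hcen : D.center - C.center = (x⁻¹ : ℝ) * (z - C.center) := by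
    rw [hw]
    have : (x : ℂ) ≠ 0 := by exact_mod_cast hx
    push_cast; field_simp
  -- This is the ratio of the homothety with center `z` that takes `C` to `D`. It lies between 0 and
  -- 1 exactly if `D` touches `C` from the inside.
  refine ⟨1 - x⁻¹, ?_, ?_, ?_⟩
  · intro h1
    exact inv_ne_zero hx (by linarith)
  · rw [sub_sub_cancel, ← hcen]; ring
  · have h3 : z - D.center = ((1 - x⁻¹ : ℝ) : ℂ) * (z - C.center) := by
      push_cast at hcen ⊢; linear_combination -hcen
    have h4 : ‖z - D.center‖ = D.radius := by
      rw [← dist_eq_norm]; exact hz.2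
    have h5 : ‖z - C.center‖ = C.radius := by
      rw [← dist_eq_norm]; exact hz.1
    rw [← h4, h3, norm_mul, h5, Complex.norm_real, Real.norm_eq_abs]

/-- This is the law of cosines for two points on the radii to `C.pt θ` and `C.pt φ`. The term with
the sine is the squared chord over the squared radius. -/
theorem normSq_sub_of_ratio (C : PlaneCircle) (θ φ ρ σ : ℝ) :
    Complex.normSq ((C.center + (1 - ρ : ℝ) * (C.pt θ - C.center)) -
      (C.center + (1 - σ : ℝ) * (C.pt φ - C.center))) =
    C.radius ^ 2 * ((ρ - σ) ^ 2 + (1 - ρ) * (1 - σ) * (4 * Real.sin ((θ - φ) / 2) ^ 2)) := by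
  have h1 : 4 * Real.sin ((θ - φ) / 2) ^ 2 =
      2 - 2 * (Real.cos θ * Real.cos φ + Real.sin θ * Real.sin φ) := by
    rw [← Real.cos_sub, Real.sin_sq_eq_half_sub, mul_div_cancel₀ _ two_ne_zero]; ring
  have h2 : ∀ t : ℝ, C.pt t - C.center = ⟨C.radius * Real.cos t, C.radius * Real.sin t⟩ := by
    intro t
    rw [pt, circleMap, add_sub_cancel_left, Complex.exp_mul_I]
    apply Complex.ext <;> simp [Complex.cos_ofReal_re, Complex.sin_ofReal_re]
  rw [h1, h2, h2, Complex.normSq_apply]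
  simp only [Complex.sub_re, Complex.add_re, Complex.re_ofReal_mul, Complex.sub_im,
    Complex.add_im, Complex.im_ofReal_mul]
  linear_combination (C.radius ^ 2 * (1 - ρ) ^ 2) * Real.sin_sq_add_cos_sq θ +
    (C.radius ^ 2 * (1 - σ) ^ 2) * Real.sin_sq_add_cos_sq φ

/-- Circles that touch `C` at points of an arc can be described by a position and a curvature-like
parameter, such that two of them meet if and only if a simple inequality holds. -/
theorem exists_tangent_parameters {ι : Type*} (C : PlaneCircle) (D : ι → PlaneCircle)
    (θ₀ : ℝ) (θ : ι → ℝ) (hθ : ∀ i, θ i ∈ Ioo θ₀ (θ₀ + 2 * Real.pi)) (hD : ∀ i, C ≠ D i)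
    (htan : ∀ i, C.points ∩ (D i).points = {C.pt (θ i)}) :
    ∃ k : ι → ℝ, ∀ i j, θ i ≠ θ j → (((D i).points ∩ (D j).points).Nonempty ↔
      (Real.cot ((θ i - θ₀) / 2) - Real.cot ((θ j - θ₀) / 2)) ^ 2 ≤ k i * k j) := by
  choose ρ hρ hcen hrad using fun i => exists_ratio_of_tangent (hD i) (htan i)
  have hs : ∀ i, 0 < Real.sin ((θ i - θ₀) / 2) := fun i =>
    Real.sin_pos_of_pos_of_lt_pi (by linarith [(hθ i).1]) (by linarith [(hθ i).2])
  -- Inversion at `C.pt θ₀` with power `2 * C.radius` turns `C` into a line on which the touching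
  -- points have the coordinates `Real.cot ((θ i - θ₀) / 2)`. The witness is the diameter of the
  -- image of `D i`, positive for circles inside `C` and negative for those outside.
  refine ⟨fun i => ρ i / (1 - ρ i) / Real.sin ((θ i - θ₀) / 2) ^ 2, fun i j hij => ?_⟩
  have hρi : 1 - ρ i ≠ 0 := sub_ne_zero.2 (hρ i).symm
  have hρj : 1 - ρ j ≠ 0 := sub_ne_zero.2 (hρ j).symm
  set si := Real.sin ((θ i - θ₀) / 2) with hsi
  set sj := Real.sin ((θ j - θ₀) / 2) with hsj
  have hsi0 : 0 < si := hs i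
  have hsj0 : 0 < sj := hs j
  have hR := C.radius_pos
  set Δ := Real.cot ((θ i - θ₀) / 2) - Real.cot ((θ j - θ₀) / 2) with hΔ
  have hsin : Real.sin ((θ j - θ i) / 2) = si * sj * Δ := by
    have : (θ j - θ i) / 2 = (θ j - θ₀) / 2 - (θ i - θ₀) / 2 := by ring
    rw [this, Real.sin_sub, hΔ, Real.cot_eq_cos_div_sin, Real.cot_eq_cos_div_sin, ← hsi, ← hsj]
    field_simp
  have hsin0 : Real.sin ((θ j - θ i) / 2) ≠ 0 := by
    intro h0
    have := (Real.sin_eq_zero_iff_of_lt_of_lt (by linarith [(hθ i).2, (hθ j).1])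
      (by linarith [(hθ j).2, (hθ i).1])).1 h0
    exact hij (by linarith)
  have hN := C.normSq_sub_of_ratio (θ j) (θ i) (ρ j) (ρ i)
  rw [← hcen, ← hcen, hsin] at hN
  have hΔ0 : Δ ≠ 0 := fun h0 => hsin0 (by rw [hsin, h0, mul_zero])
  have e1 : ((D i).radius - (D j).radius) ^ 2 + ((D i).radius + (D j).radius) ^ 2 =
      2 * C.radius ^ 2 * (ρ i ^ 2 + ρ j ^ 2) := by
    rw [hrad, hrad, ← sq_abs (ρ i), ← sq_abs (ρ j)]; ring
  have e2 : ((D i).radius - (D j).radius) ^ 2 * ((D i).radius + (D j).radius) ^ 2 =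
      (C.radius ^ 2 * (ρ i ^ 2 - ρ j ^ 2)) ^ 2 := by
    rw [hrad, hrad, ← sq_abs (ρ i), ← sq_abs (ρ j)]; ring
  -- Up to a positive factor, the criterion of `inter_nonempty_iff` is the difference of the two
  -- sides of the claimed inequality.
  have key : (Complex.normSq ((D j).center - (D i).center) - ((D i).radius - (D j).radius) ^ 2) *
      (Complex.normSq ((D j).center - (D i).center) - ((D i).radius + (D j).radius) ^ 2) =
      (C.radius ^ 2 * (1 - ρ i) * (1 - ρ j) * si ^ 2 * sj ^ 2 * Δ) ^ 2 * 16 *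
        (Δ ^ 2 - ρ i / (1 - ρ i) / si ^ 2 * (ρ j / (1 - ρ j) / sj ^ 2)) := by
    have e3 : ∀ N x y : ℝ, (N - x) * (N - y) = N ^ 2 - N * (x + y) + x * y := by intros; ring
    rw [e3, e1, e2, hN]
    field_simp
    ring
  have hpos : 0 < (C.radius ^ 2 * (1 - ρ i) * (1 - ρ j) * si ^ 2 * sj ^ 2 * Δ) ^ 2 * 16 := by
    positivity
  rw [inter_nonempty_iff, key, ← sub_nonpos (a := Δ ^ 2)]
  exact ⟨fun h => nonpos_of_mul_nonpos_right h hpos,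
    fun h => mul_nonpos_of_nonneg_of_nonpos hpos.le h⟩

end PlaneCircle

/-! ### The order of the touching points -/

/-- If two pairs of tangent circles lie on the same side, then the cross ratio of the touching
points is bounded. -/
theorem mul_abs_lt_of_tangent_pairs {a b c d ka kb kc kd : ℝ} (hab : (a - b) ^ 2 ≤ ka * kb)
    (hcd : (c - d) ^ 2 ≤ kc * kd) (hac : ka * kc < (a - c) ^ 2) (hbd : kb * kd < (b - d) ^ 2)
    (hne : a ≠ b) (hside : 0 < ka * kc) : |a - b| * |c - d| < |a - c| * |b - d| := by
  have hab' : 0 < ka * kb := lt_of_lt_of_le (by have := sub_ne_zero.2 hne; positivity) hab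
  refine lt_of_pow_lt_pow_left₀ 2 (by positivity) ?_
  rw [mul_pow, mul_pow, sq_abs, sq_abs, sq_abs, sq_abs]
  have hk : 0 ≤ kc * kd := (sq_nonneg _).trans hcd
  calc (a - b) ^ 2 * (c - d) ^ 2 ≤ (ka * kb) * (kc * kd) :=
        mul_le_mul hab hcd (sq_nonneg _) hab'.le
    _ = (ka * kc) * (kb * kd) := by ring
    _ < (a - c) ^ 2 * (b - d) ^ 2 := by
        -- The other signs leave only the value 0 in the first case, where the bound is immediate.
        rcases le_or_gt (kb * kd) 0 with h | h
        · have h1 : 0 ≤ (b - d) ^ 2 := sq_nonneg _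
          have h2 : 0 ≤ (ka * kc) * (kb * kd) := by
            have : (ka * kc) * (kb * kd) = (ka * kb) * (kc * kd) := by ring
            rw [this]; positivity
          have h3 : kb * kd = 0 := le_antisymm h (nonneg_of_mul_nonneg_right h2 hside)
          rw [h3] at hbd ⊢
          rw [mul_zero]
          exact mul_pos (hside.trans hac) hbd
        · exact mul_lt_mul'' hac hbd hside.le h.le

/-- Eight circles that touch a line in the order `0, …, 7`, such that the circles `0` and `5`,
`1` and `4`, `2` and `7`, `3` and `6` meet, cannot be pairwise disjoint otherwise. -/
theorem not_four_tangent_pairs {t k : Fin 8 → ℝ} (ht : StrictMono t)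
    (hmeet : ∀ g, (t (gadgetEnd g 0) - t (gadgetEnd g 1)) ^ 2 ≤
      k (gadgetEnd g 0) * k (gadgetEnd g 1))
    (hdisj : ∀ g g' s s', g ≠ g' → k (gadgetEnd g s) * k (gadgetEnd g' s') <
      (t (gadgetEnd g s) - t (gadgetEnd g' s')) ^ 2) : False := by
  have hlt : ∀ i j : Fin 8, i < j → t i < t j := fun i j h => ht h
  have h01 := hlt 0 1 (by decide)
  have h12 := hlt 1 2 (by decide)
  have h23 := hlt 2 3 (by decide)
  have h34 := hlt 3 4 (by decide)
  have h45 := hlt 4 5 (by decide)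
  have h56 := hlt 5 6 (by decide)
  have h67 := hlt 6 7 (by decide)
  have hends : ∀ g, gadgetEnd g 0 ≠ gadgetEnd g 1 := by decide
  have hne : ∀ g, t (gadgetEnd g 0) ≠ t (gadgetEnd g 1) := fun g h => hends g (ht.injective h)
  have hkey : ∀ g g', g ≠ g' → 0 < k (gadgetEnd g 0) * k (gadgetEnd g' 0) →
      |t (gadgetEnd g 0) - t (gadgetEnd g 1)| * |t (gadgetEnd g' 0) - t (gadgetEnd g' 1)| <
      |t (gadgetEnd g 0) - t (gadgetEnd g' 0)| * |t (gadgetEnd g 1) - t (gadgetEnd g' 1)| :=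
    fun g g' hgg hside => mul_abs_lt_of_tangent_pairs (hmeet g) (hmeet g') (hdisj g g' 0 0 hgg)
      (hdisj g g' 1 1 hgg) (hne g) hside
  have hk0 : ∀ g, k (gadgetEnd g 0) ≠ 0 := by
    intro g h
    have h1 := hmeet g
    rw [h, zero_mul] at h1
    have := sub_ne_zero.2 (hne g)
    exact absurd h1 (not_le.2 (by positivity))
  have a0 := hk0 0
  have a1 := hk0 1
  have a2 := hk0 2
  have a3 := hk0 3
  have k02 := hkey 0 2 (by decide)
  have k03 := hkey 0 3 (by decide)
  have k12 := hkey 1 2 (by decide)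
  have k01 := hkey 0 1 (by decide)
  have k23 := hkey 2 3 (by decide)
  simp only [gadgetEnd, Matrix.cons_val] at a0 a1 a2 a3 k02 k03 k12 k01 k23
  have habs : ∀ x y : ℝ, x < y → |x - y| = y - x := fun x y h => by
    rw [abs_sub_comm, abs_of_pos (by linarith)]
  have habs' : ∀ x y : ℝ, x < y → |y - x| = y - x := fun x y h => abs_of_pos (by linarith)
  rw [habs _ _ (by linarith), habs _ _ (by linarith), habs _ _ (by linarith),
    habs _ _ (by linarith)] at k02 k03 k12
  rw [habs _ _ (by linarith), habs _ _ (by linarith), habs _ _ (by linarith),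
    habs' _ _ (by linarith)] at k01 k23
  -- Interleaved pairs lie on opposite sides: the two distances within the pairs are larger than the
  -- two distances across them.
  have n02 : k 0 * k 2 < 0 := by
    refine lt_of_le_of_ne (not_lt.1 fun h => ?_) (mul_ne_zero a0 a2)
    have := k02 h
    nlinarith [mul_pos (sub_pos.2 h12) (sub_pos.2 h56)]
  have n03 : k 0 * k 3 < 0 := by
    refine lt_of_le_of_ne (not_lt.1 fun h => ?_) (mul_ne_zero a0 a3)
    have := k03 h
    nlinarith
  have n12 : k 1 * k 2 < 0 := by
    refine lt_of_le_of_ne (not_lt.1 fun h => ?_) (mul_ne_zero a1 a2)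
    have := k12 h
    nlinarith
  -- Being opposite to a common pair, gadgets 0 and 1 lie on one side; likewise 2 and 3.
  have p01 : 0 < k 0 * k 1 := by
    have : 0 < (k 0 * k 1) * (k 2) ^ 2 := by nlinarith [mul_pos_of_neg_of_neg n02 n12]
    exact pos_of_mul_pos_left this (sq_nonneg _)
  have p23 : 0 < k 2 * k 3 := by
    have : 0 < (k 2 * k 3) * (k 0) ^ 2 := by nlinarith [mul_pos_of_neg_of_neg n02 n03]
    exact pos_of_mul_pos_left this (sq_nonneg _)
  have q01 := k01 p01
  have q23 := k23 p23
  -- In the product inequality for nested pairs, the outer distance exceeds one factor on the right,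
  -- so the inner distance must be smaller than the other factor.
  have r1 : t 4 - t 1 < t 5 - t 4 := by
    by_contra! h
    nlinarith [mul_pos (sub_pos.2 h01) (sub_pos.2 h45)]
  have r2 : t 6 - t 3 < t 3 - t 2 := by
    by_contra! h
    nlinarith
  -- The cycle is `t 5 - t 4 < t 6 - t 3 < t 3 - t 2 < t 4 - t 1 < t 5 - t 4`.
  linarith

/-! ### The neighbours of the vertices of the augmented octahedron -/

/-- The vertices `u, z_1, …, z_8, v` of the path that replaces the edge `e = (u, v)`. -/
def pathVertex (e : OctEdge) : Fin 10 → AugVertex :=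
  ![.oct e.1.1, .sub e 0, .sub e 1, .sub e 2, .sub e 3, .sub e 4, .sub e 5, .sub e 6, .sub e 7,
    .oct e.1.2]

/-- The number of the gadget, and its side, that has `z_{i+1}` as an endpoint. -/
def gadgetOf : Fin 8 → Fin 4 × Fin 2 :=
  ![(0, 0), (1, 0), (2, 0), (3, 0), (1, 1), (0, 1), (3, 1), (2, 1)]

theorem gadgetEnd_gadgetOf : ∀ i, gadgetEnd (gadgetOf i).1 (gadgetOf i).2 = i := by decide

theorem gadgetOf_gadgetEnd : ∀ k s, gadgetOf (gadgetEnd k s) = (k, s) := by decide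

/-- The neighbours of a vertex of the augmented octahedron. -/
def nbrs : AugVertex → Finset AugVertex
  | .oct u => ((Finset.univ.filter fun e : OctEdge => e.1.1 = u).image fun e => .sub e 0) ∪
      ((Finset.univ.filter fun e : OctEdge => e.1.2 = u).image fun e => .sub e 7)
  | .sub e i => {pathVertex e i.castSucc.castSucc, pathVertex e i.succ.succ,
      .mid e (gadgetOf i).1, .att e (gadgetOf i).1 (gadgetOf i).2}
  | .mid e k => {.sub e (gadgetEnd k 0), .sub e (gadgetEnd k 1), .att e k 0, .att e k 1}
  | .att e k s => {.sub e (gadgetEnd k s), .mid e k, .loop e k s 0, .loop e k s 1}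
  | .loop e k s x => ((Finset.univ.filter fun y => octahedron.Adj x y ∧ s(x, y) ≠ s(0, 1)).image
      fun y => .loop e k s y) ∪ if x = 0 ∨ x = 1 then {.att e k s} else ∅

theorem AugEdge.ne {a b : AugVertex} (h : AugEdge a b) : a ≠ b := by
  cases h with
  | next e i => simp [Fin.ext_iff]
  | loopLoop e k s x y hxy hne => simpa using hxy.ne
  | _ => simp

theorem augEdge_path (e : OctEdge) (j : Fin 9) :
    AugEdge (pathVertex e j.castSucc) (pathVertex e j.succ) := by
  fin_cases j
  · exact .first e
  · exact .next e 0
  · exact .next e 1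
  · exact .next e 2
  · exact .next e 3
  · exact .next e 4
  · exact .next e 5
  · exact .next e 6
  · exact .last e

theorem pathVertex_succ_castSucc (e : OctEdge) (i : Fin 8) :
    pathVertex e i.succ.castSucc = .sub e i := by
  fin_cases i <;> rfl

theorem AugEdge.mem_nbrs {a b : AugVertex} (h : AugEdge a b) : b ∈ nbrs a ∧ a ∈ nbrs b := by
  cases h with
  | first e => simp [nbrs, pathVertex]
  | next e i => fin_cases i <;> simp [nbrs, pathVertex]
  | last e => simp [nbrs, pathVertex]
  | endMid e k s =>
    have := gadgetOf_gadgetEnd k s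
    fin_cases s <;> simp_all [nbrs]
  | endAtt e k s => simp [nbrs, gadgetOf_gadgetEnd]
  | attMid e k s => fin_cases s <;> simp [nbrs]
  | attLoopZero e k s => simp [nbrs]
  | attLoopOne e k s => simp [nbrs]
  | loopLoop e k s x y hxy hne =>
    have hne' : s(y, x) ≠ s(0, 1) := by rwa [Sym2.eq_swap]
    simp only [nbrs, Finset.mem_union, Finset.mem_image, Finset.mem_filter, Finset.mem_univ,
      true_and]
    exact ⟨Or.inl ⟨y, ⟨hxy, hne⟩, rfl⟩, Or.inl ⟨x, ⟨hxy.symm, hne'⟩, rfl⟩⟩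

theorem augEdge_of_mem_nbrs {a b : AugVertex} (h : b ∈ nbrs a) : AugEdge a b ∨ AugEdge b a := by
  cases a with
  | oct u =>
    simp only [nbrs, Finset.mem_union, Finset.mem_image, Finset.mem_filter, Finset.mem_univ,
      true_and] at h
    rcases h with ⟨e, rfl, rfl⟩ | ⟨e, rfl, rfl⟩
    · exact Or.inl (.first e)
    · exact Or.inr (.last e)
  | sub e i =>
    simp only [nbrs, Finset.mem_insert, Finset.mem_singleton] at h
    have hg := gadgetEnd_gadgetOf i
    rcases h with rfl | rfl | rfl | rfl
    · right
      have := augEdge_path e i.castSucc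
      rwa [Fin.succ_castSucc, pathVertex_succ_castSucc] at this
    · left
      have := augEdge_path e i.succ
      rwa [pathVertex_succ_castSucc] at this
    · left
      have := AugEdge.endMid e (gadgetOf i).1 (gadgetOf i).2
      rwa [hg] at this
    · left
      have := AugEdge.endAtt e (gadgetOf i).1 (gadgetOf i).2
      rwa [hg] at this
  | mid e k =>
    simp only [nbrs, Finset.mem_insert, Finset.mem_singleton] at h
    rcases h with rfl | rfl | rfl | rfl
    · exact Or.inr (.endMid e k 0)
    · exact Or.inr (.endMid e k 1)
    · exact Or.inr (.attMid e k 0)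
    · exact Or.inr (.attMid e k 1)
  | att e k s =>
    simp only [nbrs, Finset.mem_insert, Finset.mem_singleton] at h
    rcases h with rfl | rfl | rfl | rfl
    · exact Or.inr (.endAtt e k s)
    · exact Or.inl (.attMid e k s)
    · exact Or.inl (.attLoopZero e k s)
    · exact Or.inl (.attLoopOne e k s)
  | loop e k s x =>
    simp only [nbrs, Finset.mem_union, Finset.mem_image, Finset.mem_filter, Finset.mem_univ,
      true_and] at h
    rcases h with ⟨y, hy, rfl⟩ | h
    · exact Or.inl (.loopLoop e k s x y hy.1 hy.2)
    · split_ifs at h with hx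
      · rw [Finset.mem_singleton] at h
        subst h
        rcases hx with rfl | rfl
        · exact Or.inr (.attLoopZero e k s)
        · exact Or.inr (.attLoopOne e k s)
      · simp at h

theorem AugEdge.adj {a b : AugVertex} (h : AugEdge a b) : augmentedOctahedron.Adj a b :=
  (SimpleGraph.fromRel_adj _ _ _).2 ⟨h.ne, Or.inl h⟩

theorem adj_iff_mem_nbrs {a b : AugVertex} : augmentedOctahedron.Adj a b ↔ b ∈ nbrs a := by
  constructor
  · intro h
    rcases ((SimpleGraph.fromRel_adj _ _ _).1 h).2 with h | h
    · exact h.mem_nbrs.1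
    · exact h.mem_nbrs.2
  · intro h
    rcases augEdge_of_mem_nbrs h with h | h
    · exact h.adj
    · exact h.adj.symm

theorem card_nbrs (v : AugVertex) : (nbrs v).card = 4 := by
  cases v with
  | oct u => revert u; decide +kernel
  | sub e i => revert e i; decide +kernel
  | mid e k => revert e k; decide +kernel
  | att e k s => revert e k s; decide +kernel
  | loop e k s x => revert e k s x; decide +kernel

theorem augmentedOctahedron_isRegular : augmentedOctahedron.IsRegularOfDegree 4 := by
  intro v
  rw [← SimpleGraph.card_neighborFinset_eq_degree, ← card_nbrs v]
  congr 1
  ext w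
  rw [SimpleGraph.mem_neighborFinset, adj_iff_mem_nbrs]

/-! ### Connectedness -/

theorem augmentedOctahedron_connected : augmentedOctahedron.Connected := by
  have hpath : ∀ e j, augmentedOctahedron.Reachable (.oct e.1.1) (pathVertex e j) := by
    intro e j
    induction j using Fin.induction with
    | zero => rfl
    | succ j ih => exact ih.trans (augEdge_path e j).adj.reachable
  have hoct : ∀ u, augmentedOctahedron.Reachable (.oct 0) (.oct u) := by
    have h : ∀ e : OctEdge, augmentedOctahedron.Reachable (.oct e.1.1) (.oct e.1.2) :=
      fun e => hpath e 9
    have h1 := h ⟨(0, 1), by decide⟩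
    intro u
    fin_cases u
    · rfl
    · exact h1
    · exact h ⟨(0, 2), by decide⟩
    · exact h ⟨(0, 3), by decide⟩
    · exact h ⟨(0, 4), by decide⟩
    · exact h1.trans (h ⟨(1, 5), by decide⟩)
  have hsub : ∀ e i, augmentedOctahedron.Reachable (.oct 0) (.sub e i) := fun e i =>
    (hoct _).trans (pathVertex_succ_castSucc e i ▸ hpath e i.succ.castSucc)
  have hatt : ∀ e k s, augmentedOctahedron.Reachable (.oct 0) (.att e k s) := fun e k s =>
    (hsub e _).trans (AugEdge.endAtt e k s).adj.reachable
  have hloop : ∀ e k s x, augmentedOctahedron.Reachable (.oct 0) (.loop e k s x) := by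
    intro e k s x
    have h0 := (hatt e k s).trans (AugEdge.attLoopZero e k s).adj.reachable
    have h1 := (hatt e k s).trans (AugEdge.attLoopOne e k s).adj.reachable
    have step : ∀ x y, octahedron.Adj x y ∧ s(x, y) ≠ s(0, 1) →
        augmentedOctahedron.Reachable (.loop e k s x) (.loop e k s y) := fun x y h =>
      (AugEdge.loopLoop e k s x y h.1 h.2).adj.reachable
    fin_cases x
    · exact h0
    · exact h1
    · exact h0.trans (step 0 2 (by decide))
    · exact h0.trans (step 0 3 (by decide))
    · exact h0.trans (step 0 4 (by decide))
    · exact h1.trans (step 1 5 (by decide))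
  rw [SimpleGraph.connected_iff_exists_forall_reachable]
  refine ⟨.oct 0, fun v => ?_⟩
  cases v with
  | oct u => exact hoct u
  | sub e i => exact hsub e i
  | mid e k => exact (hsub e _).trans (AugEdge.endMid e k 0).adj.reachable
  | att e k s => exact hatt e k s
  | loop e k s x => exact hloop e k s x

/-! ### Cut vertices -/

theorem mem_nbrs_loop {e : OctEdge} {k : Fin 4} {s : Fin 2} {x : Fin 6} {v : AugVertex}
    (h : v ∈ nbrs (.loop e k s x)) : v = .att e k s ∨ ∃ y, v = .loop e k s y := by
  simp only [nbrs, Finset.mem_union, Finset.mem_image] at h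
  rcases h with ⟨y, -, rfl⟩ | h
  · exact Or.inr ⟨y, rfl⟩
  · split_ifs at h
    · exact Or.inl (Finset.mem_singleton.1 h)
    · simp at h

/-- Once w_i is deleted, no edge leaves the six remaining vertices of its loop-subgraph, so they
cannot reach w. -/
theorem isCutVertex_att (e : OctEdge) (k : Fin 4) (s : Fin 2) :
    IsCutVertex augmentedOctahedron (.att e k s) := by
  intro hconn
  have hclosed : ∀ a b : ({AugVertex.att e k s}ᶜ : Set AugVertex),
      (augmentedOctahedron.induce {AugVertex.att e k s}ᶜ).Reachable a b →
      (∃ x, a.1 = .loop e k s x) → ∃ x, b.1 = .loop e k s x := by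
    rintro a b ⟨w⟩ ha
    induction w with
    | nil => exact ha
    | cons hadj _ ih =>
      rename_i u v w _
      refine ih ?_
      obtain ⟨x, hx⟩ := ha
      have h : augmentedOctahedron.Adj u.1 v.1 := hadj
      rw [hx, adj_iff_mem_nbrs] at h
      exact (mem_nbrs_loop h).resolve_left fun h' => v.2 h'
  obtain ⟨x, hx⟩ := hclosed ⟨.loop e k s 0, by simp⟩ ⟨.mid e k, by simp⟩ (hconn _ _) ⟨0, rfl⟩
  simp at hx

/-! ### Edges on circles -/

namespace CircleRealization

variable {V : Type*} {G : SimpleGraph V} (R : CircleRealization G)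

/-- The edge `(v, w)` is drawn on the circle `C`. -/
def On (C : PlaneCircle) (v w : V) : Prop := ∃ h : G.Adj v w, R.circ ⟨s(v, w), h⟩ = C

variable {R} {C D : PlaneCircle} {v w : V}

theorem On.adj (h : R.On C v w) : G.Adj v w := h.1

theorem On.symm (h : R.On C v w) : R.On C w v := by
  obtain ⟨h, rfl⟩ := h
  refine ⟨h.symm, ?_⟩
  congr 2
  exact Sym2.eq_swap

theorem On.unique (h : R.On C v w) (h' : R.On D v w) : C = D := by
  obtain ⟨h, rfl⟩ := h
  obtain ⟨-, rfl⟩ := h'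
  rfl

theorem On.mem (h : R.On C v w) : C ∈ R.S := by
  obtain ⟨h, rfl⟩ := h
  exact R.circ_mem _

theorem On.left (h : R.On C v w) : R.p v ∈ C.points := by
  obtain ⟨h, rfl⟩ := h
  exact R.p_mem_circ _ (Sym2.mem_mk_left v w)

theorem On.right (h : R.On C v w) : R.p w ∈ C.points := h.symm.left

variable (R) in
theorem exists_on (h : G.Adj v w) : ∃ C, R.On C v w := ⟨_, h, rfl⟩

variable (R) in
theorem on_of_mem {f : G.edgeSet} (hv : v ∈ (f : Sym2 V)) :
    ∃ w, (f : Sym2 V) = s(v, w) ∧ R.On (R.circ f) v w := by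
  obtain ⟨f, hf⟩ := f
  obtain ⟨w, rfl⟩ := Sym2.mem_iff_exists.1 hv
  exact ⟨w, rfl, hf, rfl⟩

theorem On.partner [Finite V] (h : R.On C v w) : ∃ w', w' ≠ w ∧ R.On C v w' := by
  obtain ⟨h, rfl⟩ := h
  obtain ⟨f, hne, hv, hc⟩ := R.exists_partner ⟨s(v, w), h⟩ (Sym2.mem_mk_left v w)
  obtain ⟨w', hf, hw'⟩ := R.on_of_mem hv
  refine ⟨w', fun h' => hne (Subtype.ext (h' ▸ hf)), hc ▸ hw'⟩

variable (R) in
theorem exists_on_of_mem [Finite V] (hC : C ∈ R.S) (hv : R.p v ∈ C.points) : ∃ w, R.On C v w := by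
  obtain ⟨f, -, -, hf, -, rfl, -⟩ := R.exists_two_edges hC hv
  obtain ⟨w, -, hw⟩ := R.on_of_mem hf
  exact ⟨w, hw⟩

theorem On.not_three [Fintype V] [DecidableRel G.Adj] (hdeg : G.degree v ≤ 4) {a b c : V}
    (ha : R.On C v a) (hb : R.On C v b) (hc : R.On C v c) (hab : a ≠ b) (hac : a ≠ c)
    (hbc : b ≠ c) : False := by
  obtain ⟨ha, hCa⟩ := ha
  obtain ⟨hb, hCb⟩ := hb
  obtain ⟨hc, hCc⟩ := hc
  have key : ∀ {x y : V} (hx : G.Adj v x) (hy : G.Adj v y), x ≠ y →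
      (⟨s(v, x), hx⟩ : G.edgeSet) ≠ ⟨s(v, y), hy⟩ := fun hx hy hxy h =>
    hxy (Sym2.congr_right.1 (congrArg Subtype.val h))
  exact R.not_three_edges hdeg (key ha hb hab) (key ha hc hac) (key hb hc hbc)
    (Sym2.mem_mk_left _ _) (Sym2.mem_mk_left _ _) (Sym2.mem_mk_left _ _)
    (hCb.trans hCa.symm) (hCc.trans hCa.symm)

/-- A symmetric relation that is preserved when one passes, along a circle, from an edge to the
next one through a vertex other than `x` holds for all or for no edges of the circle. -/
theorem On.closed [Finite V] (x : V) (X : V → V → Prop) (hsymm : ∀ u v, X u v → X v u)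
    (hX : ∀ u v w, X u v → R.On C u v → R.On C v w → v ≠ x → X v w)
    {a b c d : V} (hab : R.On C a b) (hXab : X a b) (hcd : R.On C c d) : X c d := by
  obtain ⟨hab, rfl⟩ := hab
  obtain ⟨hcd, hc⟩ := hcd
  have key := R.mem_of_circ_eq x
    {f : G.edgeSet | R.circ f = R.circ ⟨s(a, b), hab⟩ ∧ ∀ u v, (f : Sym2 V) = s(u, v) → X u v}
    ?_ (e := ⟨s(a, b), hab⟩) (f := ⟨s(c, d), hcd⟩) ?_ hc
  · exact key.2 c d rfl
  · rintro f ⟨hf, hfX⟩ g hg v hvx hvf hvg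
    refine ⟨hg.trans hf, ?_⟩
    obtain ⟨u, hu, huf⟩ := R.on_of_mem hvf
    obtain ⟨w, hw, hwg⟩ := R.on_of_mem hvg
    have h1 : X v w := hX u v w (hfX u v (hu.trans Sym2.eq_swap)) (hf ▸ huf.symm)
      (hf ▸ hg ▸ hwg) hvx
    intro c d hcd
    rw [hw, Sym2.eq_iff] at hcd
    rcases hcd with ⟨rfl, rfl⟩ | ⟨rfl, rfl⟩
    · exact h1
    · exact hsymm _ _ h1
  · refine ⟨rfl, fun u v h => ?_⟩
    have h : s(a, b) = s(u, v) := h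
    rw [Sym2.eq_iff] at h
    rcases h with ⟨rfl, rfl⟩ | ⟨rfl, rfl⟩
    · exact hXab
    · exact hsymm _ _ hXab

/-! ### The gadgets in a realization -/

variable {R : CircleRealization augmentedOctahedron} {e : OctEdge}

theorem On.mem_nbrs {v w : AugVertex} (h : R.On C v w) : w ∈ nbrs v := adj_iff_mem_nbrs.1 h.adj

/-- By 4-regularity, two edges of a circle at a vertex are all its edges there. -/
theorem On.eq_or_eq {v a b c : AugVertex} (ha : R.On C v a) (hb : R.On C v b) (hab : a ≠ b)
    (hc : R.On C v c) : c = a ∨ c = b := by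
  by_contra! h
  exact On.not_three (augmentedOctahedron_isRegular v).le ha hb hc hab h.1.symm h.2.symm

/-- A circle with an edge in a loop-subgraph has all its edges there. -/
theorem On.loop {k : Fin 4} {s : Fin 2} {x : Fin 6} {v a b : AugVertex}
    (h : R.On C v (.loop e k s x)) (hab : R.On C a b) :
    (∃ y, a = .loop e k s y) ∨ ∃ y, b = .loop e k s y := by
  -- The loop-subgraph can be left only through w_i, and a circle passes that point only once.
  refine On.closed (.att e k s)
    (fun a b => (∃ y, a = .loop e k s y) ∨ ∃ y, b = .loop e k s y) (fun _ _ h => h.symm)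
    ?_ h (Or.inr ⟨x, rfl⟩) hab
  rintro u v w hX huv - hv
  rcases hX with ⟨y, rfl⟩ | ⟨y, rfl⟩
  · exact Or.inl ((mem_nbrs_loop huv.mem_nbrs).resolve_left hv)
  · exact Or.inl ⟨y, rfl⟩

variable (R e) in
-- The circle of the edge from w_i to w cannot continue into the loop-subgraph, since `On.loop`
-- would then trap this edge there as well. Only the edge to v_i is left.
theorem exists_circle_att (k : Fin 4) (s : Fin 2) : ∃ D, R.On D (.att e k s) (.mid e k) ∧
    R.On D (.att e k s) (.sub e (gadgetEnd k s)) := by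
  obtain ⟨D, hD⟩ := R.exists_on (AugEdge.attMid e k s).adj
  obtain ⟨w, hne, hw⟩ := hD.partner
  refine ⟨D, hD, ?_⟩
  have hmem := hw.mem_nbrs
  simp only [nbrs, Finset.mem_insert, Finset.mem_singleton] at hmem
  rcases hmem with rfl | rfl | rfl | rfl
  · exact hw
  · exact absurd rfl hne
  · simpa using hw.loop hD
  · simpa using hw.loop hD

theorem gadgetEnd_injective {k k' : Fin 4} {s s' : Fin 2} (h : gadgetEnd k s = gadgetEnd k' s') :
    k = k' ∧ s = s' := by
  have := congrArg gadgetOf h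
  simpa [gadgetOf_gadgetEnd] using this

theorem eq_of_three_vertices {u v w : AugVertex} (huv : u ≠ v) (huw : u ≠ w) (hvw : v ≠ w)
    (hu : R.p u ∈ C.points) (hv : R.p v ∈ C.points) (hw : R.p w ∈ C.points)
    (hu' : R.p u ∈ D.points) (hv' : R.p v ∈ D.points) (hw' : R.p w ∈ D.points) : C = D :=
  PlaneCircle.eq_of_three_points (R.p_injective.ne huv) (R.p_injective.ne huw)
    (R.p_injective.ne hvw) hu hv hw hu' hv' hw'

/-- Each side of a gadget is a circle through three meeting points. -/
theorem exists_gadget_circles (R : CircleRealization augmentedOctahedron) (e : OctEdge)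
    (k : Fin 4) : ∃ D : Fin 2 → PlaneCircle, D 0 ≠ D 1 ∧
      ∀ s, R.On (D s) (.att e k s) (.mid e k) ∧
        R.On (D s) (.att e k s) (.sub e (gadgetEnd k s)) ∧
        R.On (D s) (.sub e (gadgetEnd k s)) (.mid e k) := by
  choose D hmid hend using R.exists_circle_att e k
  have hz : (AugVertex.sub e (gadgetEnd k 0)) ≠ .sub e (gadgetEnd k 1) := by
    simp only [ne_eq, AugVertex.sub.injEq, true_and]
    exact fun h => absurd (gadgetEnd_injective h).2 (by decide)
  have hsw : ∀ s, s = 0 ∨ s = (1 : Fin 2) := by decide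
  obtain ⟨E, hE⟩ := R.exists_on (AugEdge.endMid e k 0).adj
  obtain ⟨F, hF⟩ := R.exists_on (AugEdge.endMid e k 1).adj
  have hnbrs : ∀ {C : PlaneCircle} {w : AugVertex}, R.On C (.mid e k) w →
      w = .sub e (gadgetEnd k 0) ∨ w = .sub e (gadgetEnd k 1) ∨ w = .att e k 0 ∨
        w = .att e k 1 := by
    intro C w hw
    simpa [nbrs] using hw.mem_nbrs
  -- On a common circle of both sides, the edges from w to v_1 and v_2 would be left for the other
  -- circle `E` at w. That circle would share v_1, v_2 and w with `D 0`.
  have h01 : D 0 ≠ D 1 := by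
    intro h
    have h0 := (hmid 0).symm
    have h1 := h ▸ (hmid 1).symm
    have hED : E ≠ D 0 := by
      rintro rfl
      simpa using h0.eq_or_eq h1 (by simp) hE.symm
    obtain ⟨w, hne, hw⟩ := hE.symm.partner
    have hEF : R.On E (.mid e k) (.sub e (gadgetEnd k 1)) := by
      rcases hnbrs hw with rfl | rfl | rfl | rfl
      · exact absurd rfl hne
      · exact hw
      · exact absurd (hw.unique h0) hED
      · exact absurd (hw.unique h1) hED
    exact hED (eq_of_three_vertices hz (by simp) (by simp) hE.left hEF.right hE.right
      (hend 0).right (h ▸ (hend 1).right) h0.left)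
  refine ⟨D, h01, ?_⟩
  have hED : E = D 0 ∧ F = D 1 := by
    obtain ⟨w, hne, hw⟩ := (hmid 0).symm.partner
    obtain ⟨w', hne', hw'⟩ := (hmid 1).symm.partner
    rcases hnbrs hw with rfl | rfl | rfl | rfl
    · refine ⟨hE.symm.unique hw, ?_⟩
      rcases hnbrs hw' with rfl | rfl | rfl | rfl
      · exact absurd (hw.unique hw') h01
      · exact hF.symm.unique hw'
      · exact absurd ((hmid 0).symm.unique hw') h01
      · exact absurd rfl hne'
    -- In the crossed case, where each circle continues from w to the endpoint of the other side,
    -- both would pass through v_1, v_2 and w.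
    · exfalso
      rcases hnbrs hw' with rfl | rfl | rfl | rfl
      · exact h01 (eq_of_three_vertices hz (by simp) (by simp) (hend 0).right hw.right hw.left
          hw'.right (hend 1).right hw'.left)
      · exact h01 (hw.unique hw')
      · exact h01 ((hmid 0).symm.unique hw')
      · exact hne' rfl
    · exact absurd rfl hne
    · exact absurd (hw.unique (hmid 1).symm) h01
  obtain ⟨rfl, rfl⟩ := hED
  intro s
  refine ⟨hmid s, hend s, ?_⟩
  rcases hsw s with rfl | rfl
  · exact hE
  · exact hF

/-- The circle of a side of a gadget has no other edges than those of this side. -/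
theorem On.mem_triangle {k : Fin 4} {s : Fin 2} (hwm : R.On D (.att e k s) (.mid e k))
    (hwz : R.On D (.att e k s) (.sub e (gadgetEnd k s)))
    (hzm : R.On D (.sub e (gadgetEnd k s)) (.mid e k)) {a b : AugVertex} (hab : R.On D a b) :
    a = .att e k s ∨ a = .mid e k ∨ a = .sub e (gadgetEnd k s) := by
  -- The exempted vertex is a dummy: at each of its vertices the two triangle edges are all the
  -- edges of the circle there.
  have key := On.closed (.oct 0)
    (fun a b => (a = .att e k s ∨ a = .mid e k ∨ a = .sub e (gadgetEnd k s)) ∧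
      (b = .att e k s ∨ b = .mid e k ∨ b = .sub e (gadgetEnd k s)))
    (fun _ _ h => h.symm) ?_ hwm (by simp) hab
  · exact key.1
  · rintro u v w ⟨-, hv⟩ - hvw -
    refine ⟨hv, ?_⟩
    rcases hv with rfl | rfl | rfl
    · rcases hwm.eq_or_eq hwz (by simp) hvw with rfl | rfl <;> simp
    · rcases hwm.symm.eq_or_eq hzm.symm (by simp) hvw with rfl | rfl <;> simp
    · rcases hwz.symm.eq_or_eq hzm (by simp) hvw with rfl | rfl <;> simp

variable (R e) in
/-- The path that replaces an edge of the octahedron runs on a circle, which is touched by the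
circles of the gadgets. -/
theorem exists_path_circle : ∃ (C : PlaneCircle) (D : Fin 4 → Fin 2 → PlaneCircle),
    (∀ j : Fin 9, R.On C (pathVertex e j.castSucc) (pathVertex e j.succ)) ∧
    (∀ k s, C ≠ D k s) ∧
    (∀ k s, C.points ∩ (D k s).points = {R.p (.sub e (gadgetEnd k s))}) ∧
    (∀ k, ((D k 0).points ∩ (D k 1).points).Nonempty) ∧
    (∀ k k' s s', k ≠ k' → ¬ ((D k s).points ∩ (D k' s').points).Nonempty) := by
  choose D hD01 hD using R.exists_gadget_circles e
  have htri : ∀ k s {a b}, R.On (D k s) a b →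
      a = .att e k s ∨ a = .mid e k ∨ a = .sub e (gadgetEnd k s) := fun k s a b hab =>
    On.mem_triangle (hD k s).1 (hD k s).2.1 (hD k s).2.2 hab
  have hvert : ∀ k s v, R.p v ∈ (D k s).points →
      v = .att e k s ∨ v = .mid e k ∨ v = .sub e (gadgetEnd k s) := by
    intro k s v hv
    obtain ⟨w, hw⟩ := R.exists_on_of_mem (hD k s).1.mem hv
    exact htri k s hw
  have hpath_ne : ∀ (i : Fin 8) k s, pathVertex e i.castSucc.castSucc ≠ .att e k s ∧
      pathVertex e i.castSucc.castSucc ≠ .mid e k ∧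
      pathVertex e i.castSucc.castSucc ≠ .sub e i := by
    intro i k s
    fin_cases i <;> simp [pathVertex]
  have hpath_tri : ∀ (i : Fin 8) k s, gadgetEnd k s = i →
      ¬ R.On (D k s) (pathVertex e i.castSucc.castSucc) (.sub e i) := by
    intro i k s hks h
    have h1 := hpath_ne i k s
    rcases htri k s h with h2 | h2 | h2
    · exact h1.1 h2
    · exact h1.2.1 h2
    · exact h1.2.2 (hks ▸ h2)
  obtain ⟨C, hC₀⟩ := R.exists_on (augEdge_path e 0).adj
  have hC : ∀ j : Fin 9, R.On C (pathVertex e j.castSucc) (pathVertex e j.succ) := by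
    intro j
    induction j using Fin.induction with
    | zero => exact hC₀
    | succ i ih =>
      rw [Fin.succ_castSucc, pathVertex_succ_castSucc] at ih
      rw [pathVertex_succ_castSucc]
      have hg := gadgetEnd_gadgetOf i
      have hDi := hD (gadgetOf i).1 (gadgetOf i).2
      rw [hg] at hDi
      -- Both gadget edges at z_{i+1} belong to the gadget circle, which contains no path edge, so
      -- the path edge must be continued by the next path edge.
      obtain ⟨w, hne, hw⟩ := ih.symm.partner
      have hmem := hw.mem_nbrs
      simp only [nbrs, Finset.mem_insert, Finset.mem_singleton] at hmem
      rcases hmem with rfl | rfl | rfl | rfl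
      · exact absurd rfl hne
      · exact hw
      · exact absurd (hw.unique hDi.2.2 ▸ ih) (hpath_tri i _ _ hg)
      · exact absurd (hw.unique hDi.2.1.symm ▸ ih) (hpath_tri i _ _ hg)
  have hC₀ : R.On C (.oct e.1.1) (.sub e 0) := hC 0
  have hCD : ∀ k s, C ≠ D k s := by
    rintro k s rfl
    simpa using htri k s hC₀
  have hCsub : ∀ i, R.p (.sub e i) ∈ C.points := by
    intro i
    have := (hC i.succ).left
    rwa [pathVertex_succ_castSucc] at this
  refine ⟨C, D, hC, hCD, ?_, ?_, ?_⟩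
  · intro k s
    apply Set.eq_singleton_iff_unique_mem.2
    refine ⟨⟨hCsub _, (hD k s).2.2.left⟩, ?_⟩
    rintro x ⟨hxC, hxD⟩
    obtain ⟨v, rfl⟩ := R.exists_p_eq ⟨C, hC₀.mem, D k s, (hD k s).1.mem, hCD k s, hxC, hxD⟩
    obtain ⟨w, hw⟩ := R.exists_on_of_mem hC₀.mem hxC
    have hmem := hw.mem_nbrs
    -- At w_i and w every edge lies on a gadget circle or in a loop-subgraph, so `C` cannot pass
    -- there.
    rcases hvert k s v hxD with rfl | rfl | rfl
    · exfalso
      simp only [nbrs, Finset.mem_insert, Finset.mem_singleton] at hmem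
      rcases hmem with rfl | rfl | rfl | rfl
      · exact hCD k s (hw.unique (hD k s).2.1)
      · exact hCD k s (hw.unique (hD k s).1)
      · simpa using hw.loop hC₀
      · simpa using hw.loop hC₀
    · exfalso
      simp only [nbrs, Finset.mem_insert, Finset.mem_singleton] at hmem
      rcases hmem with rfl | rfl | rfl | rfl
      · exact hCD k 0 (hw.unique (hD k 0).2.2.symm)
      · exact hCD k 1 (hw.unique (hD k 1).2.2.symm)
      · exact hCD k 0 (hw.unique (hD k 0).1.symm)
      · exact hCD k 1 (hw.unique (hD k 1).1.symm)
    · rfl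
  · exact fun k => ⟨_, (hD k 0).1.right, (hD k 1).1.right⟩
  · rintro k k' s s' hkk ⟨x, hx, hx'⟩
    obtain ⟨v, hv, hv'⟩ : ∃ v, R.p v ∈ (D k s).points ∧ R.p v ∈ (D k' s').points := by
      -- Circles of different gadgets are not yet known to differ, but equal circles also share a
      -- vertex.
      by_cases h : D k s = D k' s'
      · exact ⟨_, (hD k s).1.left, h ▸ (hD k s).1.left⟩
      · obtain ⟨v, rfl⟩ := R.exists_p_eq ⟨_, (hD k s).1.mem, _, (hD k' s').1.mem, h, hx, hx'⟩
        exact ⟨v, hx, hx'⟩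
    rcases hvert k s v hv with rfl | rfl | rfl <;> rcases hvert k' s' _ hv' with h | h | h <;>
      simp only [AugVertex.att.injEq, AugVertex.mid.injEq, AugVertex.sub.injEq, reduceCtorEq,
        true_and] at h
    · exact hkk h.1
    · exact hkk h
    · exact hkk (gadgetEnd_injective h).1

/-! ### The order of the vertices on a path -/

/-- There is no meeting point between the two ends of an arc. -/
theorem On.notMem_of_between {V : Type*} {G : SimpleGraph V} {R : CircleRealization G}
    {C : PlaneCircle} {v w : V} (h : R.On C v w) {θ₀ α β : ℝ}
    (h₀ : C.pt θ₀ ∈ meetingPoints R.S) (hα : α ∈ Ioo θ₀ (θ₀ + 2 * Real.pi))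
    (hβ : β ∈ Ioo θ₀ (θ₀ + 2 * Real.pi)) (hv : C.pt α = R.p v) (hw : C.pt β = R.p w) {t : ℝ}
    (ht : t ∈ Ioo (min α β) (max α β)) : C.pt t ∉ meetingPoints R.S := by
  obtain ⟨h, rfl⟩ := h
  obtain ⟨a, b, hab, -, -, hends, ha, hb, hno⟩ := R.arc_eq ⟨s(v, w), h⟩
  set C := R.circ ⟨s(v, w), h⟩
  rw [Sym2.map_mk, ← hv, ← hw, Sym2.eq_iff] at hends
  have key : ∀ γ δ, γ ∈ Ioo θ₀ (θ₀ + 2 * Real.pi) → δ ∈ Ioo θ₀ (θ₀ + 2 * Real.pi) →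
      C.pt γ = C.pt a → C.pt δ = C.pt b → ∀ t ∈ Ioo γ δ ∪ Ioo δ γ,
        C.pt t ∉ meetingPoints R.S := by
    intro γ δ hγ hδ hγa hδb t ht
    obtain ⟨n, hn⟩ := C.exists_int_of_pt_eq hγa
    have hno' : ∀ t ∈ Ioo γ (b + n * (2 * Real.pi)), C.pt t ∉ meetingPoints R.S := by
      intro t ht
      have := hno (t - n * (2 * Real.pi)) ⟨by linarith [ht.1], by linarith [ht.2]⟩
      rwa [← C.pt_add_int _ n, sub_add_cancel] at this
    have hδb' : C.pt δ = C.pt (b + n * (2 * Real.pi)) := by rw [hδb, C.pt_add_int]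
    -- An arc running beyond `θ₀ + 2 * Real.pi` would contain the meeting point `C.pt θ₀` in its
    -- interior.
    have hlt : b + n * (2 * Real.pi) ≤ θ₀ + 2 * Real.pi := by
      by_contra! hlt
      exact hno' _ ⟨hγ.2, hlt⟩ (by rwa [C.pt_add_two_pi])
    have heq := C.eq_of_pt_eq hδb' (by linarith [hδ.2, hγ.1]) (by linarith [hδ.1])
    rcases ht with ht | ht
    · exact hno' t (heq ▸ ht)
    · linarith [ht.1, ht.2]
  have hmem : t ∈ Ioo α β ∪ Ioo β α := by
    rcases le_total α β with hle | hle
    · left; rwa [min_eq_left hle, max_eq_right hle] at ht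
    · right; rwa [min_eq_right hle, max_eq_left hle] at ht
  rcases hends with ⟨h1, h2⟩ | ⟨h1, h2⟩
  · exact key α β hα hβ h1 h2 t hmem
  · exact key β α hβ hα h2 h1 t (union_comm _ _ ▸ hmem)

end CircleRealization

/-! ### Monotone angles and the final contradiction -/

theorem strictMono_or_strictAnti_of_consecutive {n : ℕ} {θ : Fin (n + 1) → ℝ}
    (hinj : Function.Injective θ)
    (h : ∀ (i : Fin n) j,
      θ j ∉ Ioo (min (θ i.castSucc) (θ i.succ)) (max (θ i.castSucc) (θ i.succ))) :
    StrictMono θ ∨ StrictAnti θ := by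
  have key : ∀ θ : Fin (n + 1) → ℝ, Function.Injective θ →
      (∀ (i : Fin n) j,
        θ j ∉ Ioo (min (θ i.castSucc) (θ i.succ)) (max (θ i.castSucc) (θ i.succ))) →
      (∀ hn : 0 < n, θ (Fin.castSucc ⟨0, hn⟩) < θ (Fin.succ ⟨0, hn⟩)) → StrictMono θ := by
    intro θ hinj h h0
    have : ∀ m (hm : m < n), θ (Fin.castSucc ⟨m, hm⟩) < θ (Fin.succ ⟨m, hm⟩) := by
      intro m
      induction m with
      | zero => exact h0
      | succ m ih =>
        intro hm
        have hlt := ih (by omega)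
        -- If the direction turns, the one of the two outer values that is closer to the middle
        -- value lies between it and the other one.
        by_contra! hle
        have hlt' := lt_of_le_of_ne hle (hinj.ne (by simp [Fin.ext_iff]))
        have h1 := h ⟨m, by omega⟩ (Fin.succ ⟨m + 1, hm⟩)
        have h2 := h ⟨m + 1, hm⟩ (Fin.castSucc ⟨m, by omega⟩)
        rw [min_eq_left hlt.le, max_eq_right hlt.le] at h1
        rw [min_eq_right hlt'.le, max_eq_left hlt'.le] at h2
        have e : (Fin.castSucc ⟨m + 1, hm⟩ : Fin (n + 1)) = Fin.succ ⟨m, by omega⟩ := rfl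
        rw [e] at h2 hlt'
        have h3 : θ (Fin.succ ⟨m + 1, hm⟩) ≤ θ (Fin.castSucc ⟨m, by omega⟩) :=
          not_lt.1 fun h => h1 ⟨h, hlt'⟩
        exact h2 ⟨lt_of_le_of_ne h3 (hinj.ne (by simp [Fin.ext_iff]; omega)), hlt⟩
    exact Fin.strictMono_iff_lt_succ.2 fun i => this i i.2
  by_cases h0 : ∀ hn : 0 < n, θ (Fin.castSucc ⟨0, hn⟩) < θ (Fin.succ ⟨0, hn⟩)
  · exact Or.inl (key θ hinj h h0)
  · right
    push Not at h0
    obtain ⟨hn, h0⟩ := h0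
    have := key (fun i => -θ i) (fun i j hij => hinj (neg_injective hij)) ?_ ?_
    · exact fun i j hij => neg_lt_neg_iff.1 (this hij)
    · rintro i j ⟨h1, h2⟩
      rw [min_neg_neg, neg_lt_neg_iff] at h1
      rw [max_neg_neg, neg_lt_neg_iff] at h2
      exact h i j ⟨h2, h1⟩
    · exact fun _ => neg_lt_neg (lt_of_le_of_ne h0 (hinj.ne (by simp [Fin.ext_iff])))

theorem cot_strictAntiOn : StrictAntiOn Real.cot (Ioo 0 Real.pi) := by
  intro a ha b hb hab
  have hsa := Real.sin_pos_of_pos_of_lt_pi ha.1 ha.2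
  have hsb := Real.sin_pos_of_pos_of_lt_pi hb.1 hb.2
  rw [Real.cot_eq_cos_div_sin, Real.cot_eq_cos_div_sin, div_lt_div_iff₀ hsb hsa]
  have := Real.sin_pos_of_pos_of_lt_pi (sub_pos.2 hab) (by linarith [ha.1, hb.2])
  rw [Real.sin_sub] at this
  linarith

theorem isEmpty_circleRealization : IsEmpty (CircleRealization augmentedOctahedron) := by
  refine ⟨fun R => ?_⟩
  let e : OctEdge := ⟨(0, 1), by decide⟩
  obtain ⟨C, D, hpath, hCD, htan, hmeet, hdisj⟩ := R.exists_path_circle e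
  have hC₀ : R.On C (.oct e.1.1) (.sub e 0) := hpath 0
  -- Angles are measured from the end u of the path, which is on `C` but is none of the z_i. The z_i
  -- thus have angles in the open period, and u is the center of inversion.
  obtain ⟨θ₀, hθ₀⟩ := C.exists_pt_eq hC₀.left
  have hθ : ∀ i, ∃ θ ∈ Ioo θ₀ (θ₀ + 2 * Real.pi), C.pt θ = R.p (.sub e i) := by
    intro i
    have hi := (hpath i.succ).left
    rw [pathVertex_succ_castSucc] at hi
    obtain ⟨t, ht⟩ := C.exists_pt_eq hi
    obtain ⟨s, hs, hst⟩ :=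
      (periodic_circleMap C.center C.radius).exists_mem_Ico Real.two_pi_pos t θ₀
    have hs' : C.pt s = R.p (.sub e i) := hst.symm.trans ht
    refine ⟨s, ⟨lt_of_le_of_ne hs.1 ?_, hs.2⟩, hs'⟩
    rintro rfl
    exact absurd (R.p_injective (hθ₀.symm.trans hs')) (by simp)
  choose θ hθ hθp using hθ
  have hinj : Function.Injective θ := by
    intro i j hij
    have := R.p_injective ((hθp i).symm.trans ((congrArg C.pt hij).trans (hθp j)))
    simpa using this
  have hmono : StrictMono θ ∨ StrictAnti θ := by
    refine strictMono_or_strictAnti_of_consecutive hinj fun i j hj => ?_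
    have hon : R.On C (.sub e i.castSucc) (.sub e i.succ) := by
      have := hpath i.succ.castSucc
      rwa [Fin.succ_castSucc, pathVertex_succ_castSucc, ← Fin.succ_castSucc,
        pathVertex_succ_castSucc] at this
    refine hon.notMem_of_between (hθ₀ ▸ R.p_mem_meetingPoints _) (hθ _) (hθ _) (hθp _) (hθp _) hj ?_
    rw [hθp]
    exact R.p_mem_meetingPoints _
  let E : Fin 8 → PlaneCircle := fun i => D (gadgetOf i).1 (gadgetOf i).2
  have hE : ∀ k s, E (gadgetEnd k s) = D k s := fun k s => by simp [E, gadgetOf_gadgetEnd]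
  obtain ⟨k, hk⟩ := C.exists_tangent_parameters E θ₀ θ hθ (fun i => hCD _ _) fun i => by
    rw [htan, gadgetEnd_gadgetOf, hθp]
  have hcot : ∀ i j, θ i < θ j →
      Real.cot ((θ j - θ₀) / 2) < Real.cot ((θ i - θ₀) / 2) := fun i j hij =>
    cot_strictAntiOn ⟨by linarith [(hθ i).1], by linarith [(hθ i).2]⟩
      ⟨by linarith [(hθ j).1], by linarith [(hθ j).2]⟩ (by linarith)
  have hends : ∀ g, gadgetEnd g 0 ≠ gadgetEnd g 1 := by decide
  have hmeet' : ∀ g, (Real.cot ((θ (gadgetEnd g 0) - θ₀) / 2) -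
      Real.cot ((θ (gadgetEnd g 1) - θ₀) / 2)) ^ 2 ≤ k (gadgetEnd g 0) * k (gadgetEnd g 1) := by
    intro g
    rw [← hk _ _ (hinj.ne (hends g)), hE, hE]
    exact hmeet g
  have hdisj' : ∀ g g' s s', g ≠ g' → k (gadgetEnd g s) * k (gadgetEnd g' s') <
      (Real.cot ((θ (gadgetEnd g s) - θ₀) / 2) -
        Real.cot ((θ (gadgetEnd g' s') - θ₀) / 2)) ^ 2 := by
    intro g g' s s' hg
    rw [← not_le, ← hk _ _ (hinj.ne fun h => hg (CircleRealization.gadgetEnd_injective h).1),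
      hE, hE]
    exact hdisj g g' s s' hg
  rcases hmono with hmono | hanti
  -- The cotangent reverses the order; a change of sign restores it and does not affect the squares.
  · refine not_four_tangent_pairs (t := fun i => -Real.cot ((θ i - θ₀) / 2)) (k := k)
      (fun i j hij => neg_lt_neg (hcot i j (hmono hij))) (fun g => ?_) fun g g' s s' hg => ?_
    · rw [neg_sub_neg, sub_sq_comm]; exact hmeet' g
    · rw [neg_sub_neg, sub_sq_comm]; exact hdisj' g g' s s' hg
  · exact not_four_tangent_pairs (t := fun i => Real.cot ((θ i - θ₀) / 2)) (k := k)
      (fun i j hij => hcot j i (hanti hij)) hmeet' hdisj'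

theorem not_hasCircleRealization : ¬ HasCircleRealization augmentedOctahedron := by
  rintro ⟨S, p, arc, hp, hrange, harc, hbij⟩
  exact isEmpty_circleRealization.false ⟨S, p, arc, hp, hrange, harc, hbij⟩

/-! ### A drawing of a path with its four gadgets -/

/-- The vertices of the path that replaces an edge of the octahedron and of its gadgets. -/
inductive LocVertex : Type
  | tip (b : Fin 2)
  | sub (i : Fin 8)
  | mid (k : Fin 4)
  | att (k : Fin 4) (s : Fin 2)
  | loop (k : Fin 4) (s : Fin 2) (x : Fin 6)
  deriving DecidableEq, Fintype

namespace LocVertex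

/-- The vertex of the augmented octahedron that corresponds to `x` for the edge `e`. -/
def toAug (e : OctEdge) : LocVertex → AugVertex
  | tip b => .oct (![e.1.1, e.1.2] b)
  | sub i => .sub e i
  | mid k => .mid e k
  | att k s => .att e k s
  | loop k s x => .loop e k s x

/-- The edges of the local graph, each listed in one direction. -/
def edges : List (LocVertex × LocVertex) :=
  (tip 0, sub 0) :: (sub 7, tip 1) ::
  ((List.finRange 7).map fun i => (sub i.castSucc, sub i.succ)) ++
  (List.finRange 4).flatMap fun k => (List.finRange 2).flatMap fun s =>
    [(sub (gadgetEnd k s), mid k), (sub (gadgetEnd k s), att k s), (att k s, mid k),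
      (att k s, loop k s 0), (att k s, loop k s 1)] ++
    (([(0, 2), (0, 3), (0, 4), (1, 2), (1, 3), (1, 5), (2, 4), (2, 5), (3, 4), (3, 5), (4, 5)] :
      List (Fin 6 × Fin 6)).map fun p => (loop k s p.1, loop k s p.2))

/-- Gadgets 0 and 1 are drawn above the path and 2 and 3 below it: endpoint pairs are nested within
each group and interleaved between the groups. -/
def attCoord : Fin 4 → Fin 2 → ℕ × ℕ :=
  ![![(150, 1450), (550, 1450)], ![(230, 1200), (470, 1200)], ![(350, 550), (750, 550)],
    ![(430, 800), (670, 800)]]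

/-- The outer triangle is 0, 1, 2 and the inner one 3, 4, 5. In this frame w_i is at `(20, 0)`,
outside the missing side from 0 to 1. -/
def loopCoord : Fin 6 → ℕ × ℕ := ![(0, 30), (40, 31), (20, 100), (20, 45), (14, 60), (26, 61)]

/-- The coordinates of the vertices. The ends of the path are `(0, 1000)` and `(900, 1000)`. -/
def coord : LocVertex → ℕ × ℕ
  | tip b => (900 * b.val, 1000)
  -- The path, including its tips, follows a concave parabola, because consecutive collinear
  -- segments would fail the strict test `sepLine`.
  | sub i => (100 * (i.val + 1), 1000 + (i.val + 1) * (8 - i.val))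
  | mid k => ![(350, 1700), (350, 1300), (550, 300), (550, 700)] k
  | att k s => attCoord k s
  | loop k s x => ((attCoord k s).1 - 20 + (loopCoord x).1,
      if k.val < 2 then (attCoord k s).2 + (loopCoord x).2 else (attCoord k s).2 - (loopCoord x).2)

end LocVertex

/-! ### Integer tests for the local drawing -/

/-- `c` lies strictly to the right of the line from `a` to `b`. -/
def rightOf (a b c : ℕ × ℕ) : Bool :=
  decide (b.1 * c.2 + b.2 * a.1 + a.2 * c.1 < b.1 * a.2 + a.1 * c.2 + b.2 * c.1)

/-- The points `c` and `d` lie strictly on the same side of the line through `a` and `b`, except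
that `c` or `d` may coincide with one of `a` and `b`. -/
def sepLine (a b c d : ℕ × ℕ) : Bool :=
  [(a, b, a), (b, a, b), (a, b, b), (b, a, a)].any fun l =>
    (rightOf l.1 l.2.1 c || c == l.2.2) && (rightOf l.1 l.2.1 d || d == l.2.2)

/-- One of the lines through two segments separates them, up to a common end. -/
def sepSegments (p q : (ℕ × ℕ) × (ℕ × ℕ)) : Bool :=
  sepLine p.1 p.2 q.1 q.2 || sepLine q.1 q.2 p.1 p.2

theorem LocVertex.edges_pairwise : (LocVertex.edges.map fun p => (p.1.coord, p.2.coord)).Pairwise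
    fun p q => sepSegments p q = true := by
  decide +kernel

theorem LocVertex.coord_injective : ∀ x y : LocVertex, x.coord = y.coord → x = y := by
  decide +kernel

/-- This reduces the question whether a vertex lies on an edge to intersections of two edges. -/
theorem LocVertex.exists_edge : ∀ x : LocVertex, ∃ p ∈ LocVertex.edges, p.1 = x ∨ p.2 = x := by
  decide +kernel

/-- These are the sides of the rhombus with corners `(0, 1000)`, `(450, -800)`, `(900, 1000)` and
`(450, 2800)`, which `place e` maps onto the cell of `e`. -/
theorem LocVertex.coord_bounds : ∀ x : LocVertex, x.coord.2 ≤ 1000 + 4 * x.coord.1 ∧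
    1000 ≤ x.coord.2 + 4 * x.coord.1 ∧ x.coord.2 + 4 * x.coord.1 ≤ 4600 ∧
    4 * x.coord.1 ≤ 2600 + x.coord.2 := by
  decide +kernel

/-! ### Separation of convex hulls by lines -/

/-- The oriented area of the parallelogram spanned by `b - a` and `z - a`. -/
def cross (a b z : ℂ) : ℝ := (b.re - a.re) * (z.im - a.im) - (b.im - a.im) * (z.re - a.re)

theorem cross_combo (a b x y : ℂ) {s t : ℝ} (hst : s + t = 1) :
    cross a b (s • x + t • y) = s * cross a b x + t * cross a b y := by
  obtain rfl : t = 1 - s := by linarith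
  simp only [cross, Complex.add_im, Complex.add_re, Complex.smul_im, Complex.smul_re, smul_eq_mul]
  ring

theorem convex_cross_nonneg (a b : ℂ) : Convex ℝ {z | 0 ≤ cross a b z} := by
  intro x hx y hy s t hs ht hst
  rw [mem_ofPred_eq, cross_combo _ _ _ _ hst]
  exact add_nonneg (mul_nonneg hs hx) (mul_nonneg ht hy)

theorem convex_cross_neg (a b : ℂ) : Convex ℝ {z | cross a b z < 0} := by
  intro x hx y hy s t hs ht hst
  rw [mem_ofPred_eq, cross_combo _ _ _ _ hst]
  rw [mem_ofPred_eq] at hx hy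
  rcases hs.eq_or_lt with rfl | hs'
  · have : t = 1 := by linarith
    subst this; linarith
  · nlinarith [mul_neg_of_pos_of_neg hs' hx]

/-- A segment from `q` to a point of the open half-plane enters it immediately, even if `q` is on
the boundary line. -/
theorem convex_insert_cross_neg {a b q : ℂ} (hq : cross a b q ≤ 0) :
    Convex ℝ (insert q {z | cross a b z < 0}) := by
  have key : ∀ y, cross a b y < 0 → ∀ s t : ℝ, 0 ≤ s → 0 ≤ t → s + t = 1 →
      s • q + t • y ∈ insert q {z | cross a b z < 0} := by
    intro y hy s t hs ht hst
    rcases ht.eq_or_lt with rfl | ht'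
    · left
      have : s = 1 := by linarith
      simp [this]
    · right
      rw [mem_ofPred_eq, cross_combo _ _ _ _ hst]
      nlinarith [mul_neg_of_pos_of_neg ht' hy]
  rintro x (rfl | hx) y (rfl | hy) s t hs ht hst
  · left; rw [← add_smul, hst, one_smul]
  · exact key y hy s t hs ht hst
  · rw [add_comm]; exact key x hx t s ht hs (by linarith)
  · exact Or.inr (convex_cross_neg a b hx hy hs ht hst)

/-- If all points of `s` are on the left of a line, and all points of `t` but `q` strictly on the
right of it, then the convex hulls of `s` and `t` can have only the point `q` in common. -/
theorem eq_of_mem_convexHull_of_separated {a b q z : ℂ} {s t : Set ℂ}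
    (hs : ∀ c ∈ s, 0 ≤ cross a b c) (ht : ∀ c ∈ t, cross a b c < 0 ∨ c = q)
    (hq : cross a b q ≤ 0) (hzs : z ∈ convexHull ℝ s) (hzt : z ∈ convexHull ℝ t) :
    z = q ∧ q ∈ t := by
  have h0 : 0 ≤ cross a b z := convexHull_min hs (convex_cross_nonneg a b) hzs
  have hqt : q ∈ t := by
    by_contra hqt
    have : z ∈ {z | cross a b z < 0} := convexHull_min
      (fun c hc => (ht c hc).resolve_right fun h => hqt (h ▸ hc)) (convex_cross_neg a b) hzt
    exact not_lt.2 h0 this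
  refine ⟨?_, hqt⟩
  have : z ∈ insert q {z | cross a b z < 0} :=
    convexHull_min (fun c hc => (ht c hc).symm) (convex_insert_cross_neg hq) hzt
  exact this.resolve_right (not_lt.2 h0)

theorem cross_left (a b : ℂ) : cross a b a = 0 := by simp [cross]

theorem cross_right (a b : ℂ) : cross a b b = 0 := by simp only [cross]; ring

/-- The point with the given coordinates. -/
def natPoint (p : ℕ × ℕ) : ℂ := ⟨p.1, p.2⟩

theorem natPoint_injective : Function.Injective natPoint := by
  intro p q h
  rw [natPoint, natPoint, Complex.mk.injEq] at h
  exact Prod.ext (by exact_mod_cast h.1) (by exact_mod_cast h.2)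

theorem cross_neg_of_rightOf {a b c : ℕ × ℕ} (h : rightOf a b c = true) :
    cross (natPoint a) (natPoint b) (natPoint c) < 0 := by
  have h : b.1 * c.2 + b.2 * a.1 + a.2 * c.1 < b.1 * a.2 + a.1 * c.2 + b.2 * c.1 :=
    of_decide_eq_true h
  have h' : (b.1 * c.2 + b.2 * a.1 + a.2 * c.1 : ℝ) < b.1 * a.2 + a.1 * c.2 + b.2 * c.1 := by
    exact_mod_cast h
  simp only [cross, natPoint]
  linarith

theorem mem_of_sepLine {a b c d : ℕ × ℕ} (h : sepLine a b c d = true) {z : ℂ}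
    (h₁ : z ∈ segment ℝ (natPoint a) (natPoint b)) (h₂ : z ∈ segment ℝ (natPoint c) (natPoint d)) :
    ∃ q, z = natPoint q ∧ (q = a ∨ q = b) ∧ (q = c ∨ q = d) := by
  have key : ∀ x y q : ℕ × ℕ, (x = a ∧ y = b ∨ x = b ∧ y = a) → (q = a ∨ q = b) →
      (rightOf x y c = true ∨ c = q) → (rightOf x y d = true ∨ d = q) →
      ∃ q, z = natPoint q ∧ (q = a ∨ q = b) ∧ (q = c ∨ q = d) := by
    intro x y q hxy hq hc hd
    rw [← convexHull_pair] at h₁ h₂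
    have h0 : ∀ p ∈ ({natPoint a, natPoint b} : Set ℂ), cross (natPoint x) (natPoint y) p = 0 := by
      rintro p (rfl | rfl) <;> rcases hxy with ⟨rfl, rfl⟩ | ⟨rfl, rfl⟩ <;>
        simp only [cross_left, cross_right]
    have hqm : natPoint q ∈ ({natPoint a, natPoint b} : Set ℂ) := by
      rcases hq with rfl | rfl <;> simp
    have hcd : ∀ p ∈ ({natPoint c, natPoint d} : Set ℂ),
        cross (natPoint x) (natPoint y) p < 0 ∨ p = natPoint q := by
      rintro p (rfl | rfl)
      · exact hc.imp cross_neg_of_rightOf (congrArg natPoint)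
      · exact hd.imp cross_neg_of_rightOf (congrArg natPoint)
    obtain ⟨hz, hmem⟩ := eq_of_mem_convexHull_of_separated (fun p hp => (h0 p hp).ge) hcd
      (h0 _ hqm).le h₁ h₂
    exact ⟨q, hz, hq, hmem.imp (fun h => natPoint_injective h) fun h => natPoint_injective h⟩
  simp only [sepLine, List.any_cons, List.any_nil, Bool.or_false, Bool.or_eq_true,
    Bool.and_eq_true, beq_iff_eq] at h
  rcases h with ⟨hc, hd⟩ | ⟨hc, hd⟩ | ⟨hc, hd⟩ | ⟨hc, hd⟩
  · exact key a b a (by simp) (by simp) hc hd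
  · exact key b a b (by simp) (by simp) hc hd
  · exact key a b b (by simp) (by simp) hc hd
  · exact key b a a (by simp) (by simp) hc hd

theorem mem_of_sepSegments {p q : (ℕ × ℕ) × (ℕ × ℕ)} (h : sepSegments p q = true) {z : ℂ}
    (h₁ : z ∈ segment ℝ (natPoint p.1) (natPoint p.2))
    (h₂ : z ∈ segment ℝ (natPoint q.1) (natPoint q.2)) :
    ∃ r, z = natPoint r ∧ (r = p.1 ∨ r = p.2) ∧ (r = q.1 ∨ r = q.2) := by
  rw [sepSegments, Bool.or_eq_true] at h
  rcases h with h | h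
  · exact mem_of_sepLine h h₁ h₂
  · obtain ⟨r, hz, hq, hp⟩ := mem_of_sepLine h h₂ h₁
    exact ⟨r, hz, hp, hq⟩

namespace LocVertex

/-- The position of a vertex in the local drawing. -/
def lpos (x : LocVertex) : ℂ := natPoint x.coord

theorem lpos_injective : Function.Injective lpos := fun x y h =>
  coord_injective x y (natPoint_injective h)

theorem exists_common_vertex {p q : LocVertex × LocVertex} (hp : p ∈ edges) (hq : q ∈ edges)
    (hne : p ≠ q) {z : ℂ} (h₁ : z ∈ segment ℝ p.1.lpos p.2.lpos)
    (h₂ : z ∈ segment ℝ q.1.lpos q.2.lpos) :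
    ∃ x, z = x.lpos ∧ (x = p.1 ∨ x = p.2) ∧ (x = q.1 ∨ x = q.2) := by
  have hpair := List.pairwise_map.1 edges_pairwise
  have : Std.Symm fun p q : LocVertex × LocVertex =>
      sepSegments (p.1.coord, p.2.coord) (q.1.coord, q.2.coord) = true := by
    refine ⟨fun p q h => ?_⟩
    rw [sepSegments, Bool.or_comm]
    exact h
  have hsep := hpair.forall hp hq hne
  obtain ⟨r, rfl, hr, hr'⟩ := mem_of_sepSegments hsep h₁ h₂
  have hinj : ∀ x y : LocVertex, x.coord = y.coord → x = y := coord_injective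
  rcases hr with rfl | rfl
  · exact ⟨p.1, rfl, Or.inl rfl, hr'.imp (hinj _ _) (hinj _ _)⟩
  · exact ⟨p.2, rfl, Or.inr rfl, hr'.imp (hinj _ _) (hinj _ _)⟩

theorem eq_of_lpos_mem_segment {p : LocVertex × LocVertex} (hp : p ∈ edges) {x : LocVertex}
    (h : x.lpos ∈ segment ℝ p.1.lpos p.2.lpos) : x = p.1 ∨ x = p.2 := by
  obtain ⟨q, hq, hx⟩ := exists_edge x
  by_cases hne : p = q
  · subst hne
    exact hx.imp Eq.symm Eq.symm
  · have hxq : x.lpos ∈ segment ℝ q.1.lpos q.2.lpos := by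
      rcases hx with rfl | rfl
      · exact left_mem_segment _ _ _
      · exact right_mem_segment _ _ _
    obtain ⟨y, hy, hyp, -⟩ := exists_common_vertex hp hq hne h hxq
    rwa [lpos_injective hy]

end LocVertex

/-! ### The cells of the edges of the octahedron -/

/-- Positions of the vertices of a plane drawing of the octahedron. -/
def octCoord : Fin 6 → ℤ × ℤ := ![(0, 20), (-20, -12), (20, -12), (-5, 3), (5, 3), (0, -5)]

/-- The corners of a thin rhombus around an edge of the octahedron, in counterclockwise order,
where the drawing of the octahedron is scaled by the factor `20`. -/
def cellCorner (e : OctEdge) : Fin 4 → ℤ × ℤ :=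
  let u := octCoord e.1.1
  let v := octCoord e.1.2
  ![20 • u, (10 * (u.1 + v.1) + (v.2 - u.2), 10 * (u.2 + v.2) - (v.1 - u.1)), 20 • v,
    (10 * (u.1 + v.1) - (v.2 - u.2), 10 * (u.2 + v.2) + (v.1 - u.1))]

def intCross (a b c : ℤ × ℤ) : ℤ := (b.1 - a.1) * (c.2 - a.2) - (b.2 - a.2) * (c.1 - a.1)

/-- The line through `a` and `b` separates the cell of `e` from the cell of `f`, up to `q`. -/
def CellSeparated (a b q : ℤ × ℤ) (e f : OctEdge) : Prop :=
  (∀ j, 0 ≤ intCross a b (cellCorner e j)) ∧ intCross a b q ≤ 0 ∧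
    ∀ j, intCross a b (cellCorner f j) < 0 ∨ cellCorner f j = q

instance (a b q : ℤ × ℤ) (e f : OctEdge) : Decidable (CellSeparated a b q e f) :=
  inferInstanceAs (Decidable (_ ∧ _ ∧ _))

/-- The separating line can be taken along a side of one of the two rhombi, and the exempted point
as one of its tips. -/
theorem exists_cellSeparated : ∀ e f : OctEdge, e ≠ f → ∃ i b,
    CellSeparated (cellCorner e i) (cellCorner e (i + 1))
      (20 • octCoord (![e.1.1, e.1.2] b)) e f ∨
    CellSeparated (cellCorner f i) (cellCorner f (i + 1))
      (20 • octCoord (![f.1.1, f.1.2] b)) f e := by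
  decide +kernel

def intPoint (p : ℤ × ℤ) : ℂ := ⟨p.1, p.2⟩

theorem intPoint_injective : Function.Injective intPoint := by
  intro p q h
  rw [intPoint, intPoint, Complex.mk.injEq] at h
  exact Prod.ext (by exact_mod_cast h.1) (by exact_mod_cast h.2)

theorem cross_intPoint (a b c : ℤ × ℤ) :
    cross (intPoint a) (intPoint b) (intPoint c) = intCross a b c := by
  simp only [cross, intPoint, intCross]
  push_cast
  ring

/-- The position of a vertex of the octahedron. -/
def octPos (u : Fin 6) : ℂ := intPoint (20 • octCoord u)

theorem octPos_injective : Function.Injective octPos := by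
  intro u v h
  have key : ∀ u v, 20 • octCoord u = 20 • octCoord v → u = v := by decide
  exact key u v (intPoint_injective h)

/-- The cell of an edge of the octahedron. -/
def cell (e : OctEdge) : Set ℂ := convexHull ℝ (range fun j => intPoint (cellCorner e j))

theorem intPoint_cellCorner_mem (e : OctEdge) (j : Fin 4) : intPoint (cellCorner e j) ∈ cell e :=
  subset_convexHull ℝ _ (mem_range_self j)

theorem CellSeparated.eq_of_mem {a b q : ℤ × ℤ} {e f : OctEdge} (h : CellSeparated a b q e f)
    {z : ℂ} (he : z ∈ cell e) (hf : z ∈ cell f) :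
    z = intPoint q ∧ ∃ j, cellCorner f j = q := by
  obtain ⟨h1, h2, h3⟩ := h
  have hs : ∀ c ∈ range fun j => intPoint (cellCorner e j),
      0 ≤ cross (intPoint a) (intPoint b) c := by
    rintro _ ⟨j, rfl⟩
    rw [cross_intPoint]
    exact_mod_cast h1 j
  have ht : ∀ c ∈ range fun j => intPoint (cellCorner f j),
      cross (intPoint a) (intPoint b) c < 0 ∨ c = intPoint q := by
    rintro _ ⟨j, rfl⟩
    rw [cross_intPoint]
    exact (h3 j).imp (fun h => by exact_mod_cast h) (congrArg intPoint)
  obtain ⟨hz, j, hj⟩ := eq_of_mem_convexHull_of_separated hs ht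
    (by rw [cross_intPoint]; exact_mod_cast h2) he hf
  exact ⟨hz, j, intPoint_injective hj⟩

theorem eq_tip_of_cellCorner_eq : ∀ (e : OctEdge) (j : Fin 4) (u : Fin 6),
    cellCorner e j = 20 • octCoord u → u = e.1.1 ∨ u = e.1.2 := by
  decide +kernel

/-- Two cells have at most a vertex of the octahedron in common. -/
theorem exists_common_tip {e f : OctEdge} (hne : e ≠ f) {z : ℂ} (he : z ∈ cell e)
    (hf : z ∈ cell f) : ∃ u, z = octPos u ∧ (u = e.1.1 ∨ u = e.1.2) ∧ (u = f.1.1 ∨ u = f.1.2) := by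
  have htip : ∀ (g : OctEdge) (b : Fin 2),
      ![g.1.1, g.1.2] b = g.1.1 ∨ ![g.1.1, g.1.2] b = g.1.2 := by
    intro g b
    fin_cases b <;> simp
  obtain ⟨i, b, h | h⟩ := exists_cellSeparated e f hne
  · obtain ⟨hz, j, hj⟩ := h.eq_of_mem he hf
    exact ⟨_, hz, htip e b, eq_tip_of_cellCorner_eq f j _ hj⟩
  · obtain ⟨hz, j, hj⟩ := h.eq_of_mem hf he
    exact ⟨_, hz, eq_tip_of_cellCorner_eq e j _ hj, htip f b⟩

/-- The affine map that places the local drawing into the cell of `e`. -/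
noncomputable def place (e : OctEdge) (z : ℂ) : ℂ :=
  -- The factor 36000 is 20 times the half-height 1800 of the local rhombus: a cell is 1/20 of the
  -- length of its edge wide on either side.
  octPos e.1.1 + ⟨z.re / 900, (z.im - 1000) / 36000⟩ * (octPos e.1.2 - octPos e.1.1)

theorem place_injective (e : OctEdge) : Function.Injective (place e) := by
  intro z w h
  have hne : octPos e.1.2 - octPos e.1.1 ≠ 0 :=
    sub_ne_zero.2 (octPos_injective.ne e.2.1.ne')
  have h := mul_right_cancel₀ hne (add_left_cancel h)
  rw [Complex.mk.injEq] at h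
  exact Complex.ext (by linarith [h.1]) (by linarith [h.2])

theorem place_combo (e : OctEdge) (z w : ℂ) {s t : ℝ} (hst : s + t = 1) :
    place e (s • z + t • w) = s • place e z + t • place e w := by
  obtain rfl : t = 1 - s := by linarith
  apply Complex.ext <;> simp [place] <;> ring

theorem exists_mem_segment_of_mem_segment_place {e : OctEdge} {x y z : ℂ}
    (h : z ∈ segment ℝ (place e x) (place e y)) : ∃ w ∈ segment ℝ x y, place e w = z := by
  obtain ⟨s, t, hs, ht, hst, rfl⟩ := h
  exact ⟨_, ⟨s, t, hs, ht, hst, rfl⟩, place_combo e x y hst⟩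

theorem place_lpos_tip (e : OctEdge) (b : Fin 2) :
    place e (LocVertex.tip b).lpos = octPos (![e.1.1, e.1.2] b) := by
  fin_cases b <;> apply Complex.ext <;>
    simp [place, LocVertex.lpos, LocVertex.coord, natPoint]

theorem place_lpos_mem_cell (e : OctEdge) (x : LocVertex) : place e x.lpos ∈ cell e := by
  obtain ⟨h1, h2, h3, h4⟩ := x.coord_bounds
  obtain ⟨a, b, hab⟩ : ∃ a b, x.coord = (a, b) := ⟨_, _, rfl⟩
  rw [hab] at h1 h2 h3 h4
  simp only at h1 h2 h3 h4
  have h1 : (b : ℝ) ≤ 1000 + 4 * a := by exact_mod_cast h1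
  have h2 : (1000 : ℝ) ≤ b + 4 * a := by exact_mod_cast h2
  have h3 : (b : ℝ) + 4 * a ≤ 4600 := by exact_mod_cast h3
  have h4 : 4 * (a : ℝ) ≤ 2600 + b := by exact_mod_cast h4
  have hconv : Convex ℝ (cell e) := convex_convexHull _ _
  have key : ∀ (j : Fin 4) (r s t : ℝ), 0 ≤ r → 0 ≤ s → 0 ≤ t → r + s + t = 1 →
      r • intPoint (cellCorner e 0) + s • intPoint (cellCorner e 2) +
        t • intPoint (cellCorner e j) ∈ cell e := by
    intro j r s t hr hs ht hrst
    have := hconv.sum_mem (t := Finset.univ) (w := ![r, s, t])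
      (z := ![intPoint (cellCorner e 0), intPoint (cellCorner e 2), intPoint (cellCorner e j)])
      (by intro i _; fin_cases i <;> assumption) (by simpa [Fin.sum_univ_three] using hrst)
      (by intro i _; fin_cases i <;> exact intPoint_cellCorner_mem e _)
    simpa [Fin.sum_univ_three] using this
  rw [LocVertex.lpos, hab]
  -- The coefficients are barycentric coordinates in the triangle of the two tips and the corner on
  -- the side of the point.
  rcases le_total (1000 : ℝ) b with hb | hb
  · convert key 3 ((3600 - 4 * a - (b - 1000)) / 3600) ((4 * a - (b - 1000)) / 3600)
      ((b - 1000) / 1800) (by linarith) (by linarith) (by linarith) (by ring) using 1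
    apply Complex.ext <;> simp [place, natPoint, octPos, cellCorner, intPoint] <;> ring
  · convert key 1 ((3600 - 4 * a - (1000 - b)) / 3600) ((4 * a - (1000 - b)) / 3600)
      ((1000 - b) / 1800) (by linarith) (by linarith) (by linarith) (by ring) using 1
    apply Complex.ext <;> simp [place, natPoint, octPos, cellCorner, intPoint] <;> ring

theorem segment_place_subset_cell (e : OctEdge) (x y : LocVertex) :
    segment ℝ (place e x.lpos) (place e y.lpos) ⊆ cell e :=
  (convex_convexHull _ _).segment_subset (place_lpos_mem_cell e x) (place_lpos_mem_cell e y)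

/-! ### The drawing of the augmented octahedron -/

/-- The position of a vertex in a plane drawing of the augmented octahedron. -/
noncomputable def augPos : AugVertex → ℂ
  | .oct u => octPos u
  | .sub e i => place e (LocVertex.sub i).lpos
  | .mid e k => place e (LocVertex.mid k).lpos
  | .att e k s => place e (LocVertex.att k s).lpos
  | .loop e k s x => place e (LocVertex.loop k s x).lpos

theorem augPos_toAug (e : OctEdge) (x : LocVertex) : augPos (x.toAug e) = place e x.lpos := by
  cases x with
  | tip b => exact (place_lpos_tip e b).symm
  | _ => rfl

theorem exists_toAug_eq (v : AugVertex) : ∃ (e : OctEdge) (x : LocVertex), x.toAug e = v := by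
  cases v with
  | oct u =>
    have h : ∀ u : Fin 6, ∃ e : OctEdge, ∃ b : Fin 2, ![e.1.1, e.1.2] b = u := by decide
    obtain ⟨e, b, h⟩ := h u
    exact ⟨e, .tip b, congrArg AugVertex.oct h⟩
  | sub e i => exact ⟨e, .sub i, rfl⟩
  | mid e k => exact ⟨e, .mid k, rfl⟩
  | att e k s => exact ⟨e, .att k s, rfl⟩
  | loop e k s x => exact ⟨e, .loop k s x, rfl⟩

theorem exists_tip {e : OctEdge} {u : Fin 6} (h : u = e.1.1 ∨ u = e.1.2) :
    ∃ b : Fin 2, (LocVertex.tip b).toAug e = .oct u ∧ place e (LocVertex.tip b).lpos = octPos u := by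
  rcases h with rfl | rfl
  · exact ⟨0, rfl, place_lpos_tip e 0⟩
  · exact ⟨1, rfl, place_lpos_tip e 1⟩

/-- A vertex whose position belongs to two cells is the common end of the two edges. -/
theorem toAug_eq_oct {e f : OctEdge} (hne : e ≠ f) {x : LocVertex} (h : place e x.lpos ∈ cell f) :
    ∃ u, x.toAug e = .oct u ∧ (u = f.1.1 ∨ u = f.1.2) := by
  obtain ⟨u, hz, hue, huf⟩ := exists_common_tip hne (place_lpos_mem_cell e x) h
  obtain ⟨b, hb, hb'⟩ := exists_tip hue
  refine ⟨u, ?_, huf⟩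
  rw [← hb, LocVertex.lpos_injective (place_injective e (hz.trans hb'.symm))]

theorem augPos_injective : Function.Injective augPos := by
  intro v w h
  obtain ⟨e, x, rfl⟩ := exists_toAug_eq v
  obtain ⟨f, y, rfl⟩ := exists_toAug_eq w
  rw [augPos_toAug, augPos_toAug] at h
  by_cases hef : e = f
  · subst hef
    rw [LocVertex.lpos_injective (place_injective e h)]
  · obtain ⟨u, hu, -⟩ := toAug_eq_oct hef (h ▸ place_lpos_mem_cell f y)
    obtain ⟨u', hu', -⟩ := toAug_eq_oct (Ne.symm hef) (h ▸ place_lpos_mem_cell e x)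
    rw [← augPos_toAug, ← augPos_toAug, hu, hu'] at h
    rw [hu, hu', octPos_injective h]

theorem LocVertex.loop_mem_edges (k : Fin 4) (s : Fin 2) :
    ∀ x y : Fin 6, octahedron.Adj x y → s(x, y) ≠ s(0, 1) →
      (loop k s x, loop k s y) ∈ edges ∨ (loop k s y, loop k s x) ∈ edges := by
  revert k s
  decide +kernel

theorem exists_local_edge {a b : AugVertex} (h : AugEdge a b) :
    ∃ e, ∃ p ∈ LocVertex.edges, s(a, b) = s(p.1.toAug e, p.2.toAug e) := by
  have hnext : ∀ i : Fin 7, (LocVertex.sub i.castSucc, LocVertex.sub i.succ) ∈ LocVertex.edges := by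
    decide +kernel
  have hgad : ∀ k s, (LocVertex.sub (gadgetEnd k s), LocVertex.mid k) ∈ LocVertex.edges ∧
      (LocVertex.sub (gadgetEnd k s), LocVertex.att k s) ∈ LocVertex.edges ∧
      (LocVertex.att k s, LocVertex.mid k) ∈ LocVertex.edges ∧
      (LocVertex.att k s, LocVertex.loop k s 0) ∈ LocVertex.edges ∧
      (LocVertex.att k s, LocVertex.loop k s 1) ∈ LocVertex.edges := by
    decide +kernel
  cases h with
  | first e => exact ⟨e, (.tip 0, .sub 0), by decide +kernel, rfl⟩
  | next e i => exact ⟨e, _, hnext i, rfl⟩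
  | last e => exact ⟨e, (.sub 7, .tip 1), by decide +kernel, rfl⟩
  | endMid e k s => exact ⟨e, _, (hgad k s).1, rfl⟩
  | endAtt e k s => exact ⟨e, _, (hgad k s).2.1, rfl⟩
  | attMid e k s => exact ⟨e, _, (hgad k s).2.2.1, rfl⟩
  | attLoopZero e k s => exact ⟨e, _, (hgad k s).2.2.2.1, rfl⟩
  | attLoopOne e k s => exact ⟨e, _, (hgad k s).2.2.2.2, rfl⟩
  | loopLoop e k s x y hxy hne =>
    rcases LocVertex.loop_mem_edges k s x y hxy hne with h | h
    · exact ⟨e, _, h, rfl⟩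
    · exact ⟨e, _, h, Sym2.eq_swap⟩

theorem exists_local_edge_of_mem_edgeSet {ε : Sym2 AugVertex}
    (h : ε ∈ augmentedOctahedron.edgeSet) :
    ∃ e, ∃ p ∈ LocVertex.edges, ε = s(p.1.toAug e, p.2.toAug e) := by
  induction ε using Sym2.ind with
  | _ a b =>
    rcases ((SimpleGraph.fromRel_adj _ _ _).1 h).2 with h | h
    · exact exists_local_edge h
    · rw [Sym2.eq_swap]; exact exists_local_edge h

/-- The segment between the positions of the ends of an edge. -/
def segmentOf {V : Type*} (p : V → ℂ) : Sym2 V → Set ℂ :=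
  Sym2.lift ⟨fun a b => segment ℝ (p a) (p b), fun _ _ => segment_symm _ _ _⟩

theorem isSimpleArc_segment {x y : ℂ} (h : x ≠ y) : IsSimpleArc (segment ℝ x y) s(x, y) := by
  refine ⟨fun t => AffineMap.lineMap x y (t : ℝ), ?_, ?_, ?_, ?_⟩
  · exact AffineMap.lineMap_continuous.comp continuous_subtype_val
  · exact (AffineMap.lineMap_injective ℝ h).comp Subtype.val_injective
  · simp
  · rw [segment_eq_image_lineMap]
    ext z
    simp [unitInterval]

theorem augmentedOctahedron_isPlanar : IsPlanar augmentedOctahedron := by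
  have hvert : ∀ ε ∈ augmentedOctahedron.edgeSet, ∀ v, augPos v ∈ segmentOf augPos ε → v ∈ ε := by
    intro ε hε v hv
    obtain ⟨e, p, hp, rfl⟩ := exists_local_edge_of_mem_edgeSet hε
    have hv' : augPos v ∈ segment ℝ (place e p.1.lpos) (place e p.2.lpos) := by
      rw [← augPos_toAug, ← augPos_toAug]; exact hv
    obtain ⟨x, rfl⟩ : ∃ x : LocVertex, x.toAug e = v := by
      obtain ⟨f, y, rfl⟩ := exists_toAug_eq v
      by_cases hfe : f = e
      · exact ⟨y, by rw [hfe]⟩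
      · rw [augPos_toAug] at hv'
        obtain ⟨u, hu, hue⟩ := toAug_eq_oct hfe (segment_place_subset_cell e _ _ hv')
        obtain ⟨b, hb, -⟩ := exists_tip hue
        exact ⟨.tip b, hb.trans hu.symm⟩
    obtain ⟨w, hw, hwx⟩ := exists_mem_segment_of_mem_segment_place hv'
    rw [augPos_toAug] at hwx
    rw [place_injective e hwx] at hw
    rw [Sym2.mem_iff]
    exact (LocVertex.eq_of_lpos_mem_segment hp hw).imp (congrArg _) (congrArg _)
  refine ⟨augPos, segmentOf augPos, augPos_injective, ?_, hvert, ?_⟩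
  · intro ε hε
    induction ε using Sym2.ind with
    | _ a b =>
      exact isSimpleArc_segment (augPos_injective.ne (augmentedOctahedron.mem_edgeSet.1 hε).ne)
  · rintro ε hε ε' hε' hne z ⟨hz, hz'⟩
    -- It suffices that a common point is the position of some vertex; by `hvert` this vertex is
    -- then an end of both edges.
    suffices h : ∃ v, augPos v = z by
      obtain ⟨v, rfl⟩ := h
      exact ⟨v, ⟨hvert ε hε v hz, hvert ε' hε' v hz'⟩, rfl⟩
    obtain ⟨e, p, hp, rfl⟩ := exists_local_edge_of_mem_edgeSet hε
    obtain ⟨f, q, hq, rfl⟩ := exists_local_edge_of_mem_edgeSet hε'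
    have h₁ : z ∈ segment ℝ (place e p.1.lpos) (place e p.2.lpos) := by
      rw [← augPos_toAug, ← augPos_toAug]; exact hz
    have h₂ : z ∈ segment ℝ (place f q.1.lpos) (place f q.2.lpos) := by
      rw [← augPos_toAug, ← augPos_toAug]; exact hz'
    by_cases hef : e = f
    · subst hef
      obtain ⟨w, hw, rfl⟩ := exists_mem_segment_of_mem_segment_place h₁
      obtain ⟨w', hw', hww'⟩ := exists_mem_segment_of_mem_segment_place h₂
      rw [place_injective e hww'] at hw'
      obtain ⟨x, rfl, -⟩ := LocVertex.exists_common_vertex hp hq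
        (by rintro rfl; exact hne rfl) hw hw'
      exact ⟨_, augPos_toAug e x⟩
    · obtain ⟨u, rfl, -⟩ := exists_common_tip hef (segment_place_subset_cell e _ _ h₁)
        (segment_place_subset_cell f _ _ h₂)
      exact ⟨.oct u, rfl⟩

end CircleSystem

theorem theorem4 :
    CircleSystem.augmentedOctahedron.Connected ∧
    CircleSystem.augmentedOctahedron.IsRegularOfDegree 4 ∧
    CircleSystem.IsPlanar CircleSystem.augmentedOctahedron ∧
    (∃ v, CircleSystem.IsCutVertex CircleSystem.augmentedOctahedron v) ∧
    ¬ CircleSystem.HasCircleRealization CircleSystem.augmentedOctahedron := by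
  exact ⟨CircleSystem.augmentedOctahedron_connected, CircleSystem.augmentedOctahedron_isRegular,
    CircleSystem.augmentedOctahedron_isPlanar,
    ⟨_, CircleSystem.isCutVertex_att ⟨(0, 1), by decide⟩ 0 0⟩,
    CircleSystem.not_hasCircleRealization⟩
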